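/- Let $\mathfrak g$ be a complex Lie algebra (of arbitrary dimension), $U\mathfrak g$ its universal enveloping algebra with its Hopf algebra structure (unit $\eta$, augmentation $\varepsilon$, coproduct written $x\mapsto\sum x^{(1)}\otimes x^{(2)}$, convolution product $\star$ on $\mathrm{End}(U\mathfrak g)$), and $U\mathfrak g^+=\ker\varepsilon$. Let $\mathfrak g$ act on the full linear duals $(U\mathfrak g)^\vee$ and $(U\mathfrak g^+)^\vee$ by $(g\cdot\varphi)(x)=\varphi(xg)$; dualizing $U\mathfrak g^+\subset U\mathfrak g\xrightarrow{\varepsilon}\mathbb C$ gives a short exact sequence of $\mathfrak g$-modules $0\to\mathbb C\to(U\mathfrak g)^\vee\to(U\mathfrak g^+)^\vee\to0$, with $\mathbb C$ the trivial module. Put $$\mathrm{pr}=\sum_{k\ge0}\frac{(-1)^k}{k+1}(\mathrm{Id}-\eta\varepsilon)^{\star(k+1)},\qquad \phi_t=\sum_{n\ge0}\frac{t^n}{n!}\,\mathrm{pr}^{\star n},\qquad A_t(x,g)=\sum_{(x)}\phi_{-t}(x^{(1)})\,\phi_t(x^{(2)}g);$$ $\mathrm{pr}$ and $A_t$ take their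 values in $\mathfrak g\subset U\mathfrak g$. A crossed module of Lie algebras is a homomorphism $\mu:\mathfrak m\to\mathfrak n$ with an action of $\mathfrak n$ on $\mathfrak m$ by derivations such that $\mu(n\cdot m)=[n,\mu(m)]$ and $\mu(m)\cdot m'=[m,m']$. For a $\mathfrak g$-module $V$, consider crossed modules with an exact sequence $0\to V\xrightarrow{i}\mathfrak m\xrightarrow{\mu}\mathfrak n\xrightarrow{\pi}\mathfrak g\to0$ ($\pi$ a Lie algebra homomorphism, $n\cdot i(v)=i(\pi(n)v)$); two of them are equivalent if they are connected by a zigzag of morphisms of crossed modules inducing the identity on $V$ and $\mathfrak g$. Such a crossed module represents $[\gamma]\in H^3(\mathfrak g,V)$ if $i\circ\gamma=d\beta$ is the formal Chevalley--Eilenberg coboundary of an alternating bilinear $\beta:\mathfrak g\times\mathfrak g\to\mathfrak m$ with $\mu(\beta(x,y))=[\rho(x),\rho(y)]-\rho([x,y])$ for a linear section $\rho$ of $\pi$. 1. For every Chevalley--Eilenberg $3$-cocycle $f:\Lambda^3\mathfrak g\to\mathbb C$, the formula $$\alpha(x,g_1,g_2)=\sum_{(x)}\int_0^1 f\big(\mathrm{pr}(x^{(1)}),A_t(x^{(2)},g_1),A_t(x^{(3)},g_2)\big)\,dt\qquad(x\in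 U\mathfrak g^+,\ g_1,g_2\in\mathfrak g)$$ defines a $2$-cocycle $\alpha$ of $\mathfrak g$ with values in $(U\mathfrak g^+)^\vee$. The Yoneda product $$0\to\mathbb C\to(U\mathfrak g)^\vee\to(U\mathfrak g^+)^\vee\oplus_\alpha\mathfrak g\to\mathfrak g\to0$$ of the above sequence with the abelian extension of $\mathfrak g$ defined by $\alpha$ (where $(U\mathfrak g)^\vee$ is an abelian Lie algebra on which the extension acts through $\mathfrak g$) is a crossed module of Lie algebras. It represents $[f]$, and its equivalence class corresponds to $[f]$: a crossed module with kernel $\mathbb C$ and cokernel $\mathfrak g$ which represents a class $c\in H^3(\mathfrak g,\mathbb C)$ is equivalent to it if and only if $c=[f]$. 2. Consequently every class $c\in H^3(\mathfrak g,\mathbb C)$ has an abelian representative of this form: there is a $3$-cocycle $f$ with $[f]=c$ such that the Yoneda product associated to $f$ represents $c$, and every crossed module which represents $c$ is equivalent to it. 3. In particular, if $\mathfrak g$ is finite-dimensional and simple with Killing form $\kappa$, this applies to the Cartan cocycle $(x,y,z)\mapsto\kappa([x,y],z)$ and to all of its scalar multiples, hence to the class of the string Lie algebra of $\mathfrak g$: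 every crossed module that represents such a class is equivalent to the Yoneda product constructed from the corresponding cocycle. -/

import Mathlib

set_option maxSynthPendingDepth 3

open scoped TensorProduct
open LieModule.Cohomology

universe u v

noncomputable section

attribute [local instance 100] LieRing.ofAssociativeRing

/-! ## Third Lie algebra cohomology -/

section Cohomology

variable (K : Type*) [CommRing K] (g : Type*) [LieRing g] [LieAlgebra K g]
variable (V : Type*) [AddCommGroup V] [Module K V]

/-- Chevalley-Eilenberg 3-cochains: alternating trilinear maps. -/
def threeCochain : Submodule K (g →ₗ[K] g →ₗ[K] g →ₗ[K] V) where
  carrier := {c | (∀ x y, c x x y = 0) ∧ ∀ x y, c x y y = 0}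
  add_mem' {a b} ha hb := by
    refine ⟨fun x y => ?_, fun x y => ?_⟩
    · simp [ha.1 x y, hb.1 x y]
    · simp [ha.2 x y, hb.2 x y]
  zero_mem' := by simp
  smul_mem' t {c} hc := by
    refine ⟨fun x y => ?_, fun x y => ?_⟩
    · simp [hc.1 x y]
    · simp [hc.2 x y]

variable [LieRingModule g V] [LieModule K g V]

/-- The value at `(x, y, z, w)` of the Chevalley-Eilenberg differential of a trilinear map. -/
def dThree (c : g →ₗ[K] g →ₗ[K] g →ₗ[K] V) (x y z w : g) : V :=
  ⁅x, c y z w⁆ - ⁅y, c x z w⁆ + ⁅z, c x y w⁆ - ⁅w, c x y z⁆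
    - c ⁅x, y⁆ z w + c ⁅x, z⁆ y w - c ⁅x, w⁆ y z
    - c ⁅y, z⁆ x w + c ⁅y, w⁆ x z - c ⁅z, w⁆ x y

/-- `Z³(g, V)`. -/
def threeCocycle : Submodule K (g →ₗ[K] g →ₗ[K] g →ₗ[K] V) where
  carrier := {c | c ∈ threeCochain K g V ∧ ∀ x y z w, dThree K g V c x y z w = 0}
  add_mem' {a b} ha hb := by
    refine ⟨add_mem ha.1 hb.1, fun x y z w => ?_⟩
    have h : dThree K g V (a + b) x y z w = dThree K g V a x y z w + dThree K g V b x y z w := by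
      simp only [dThree, LinearMap.add_apply, lie_add]
      abel
    rw [h, ha.2, hb.2, add_zero]
  zero_mem' := ⟨zero_mem _, fun x y z w => by simp [dThree]⟩
  smul_mem' t {c} hc := by
    refine ⟨Submodule.smul_mem _ t hc.1, fun x y z w => ?_⟩
    have h : dThree K g V (t • c) x y z w = t • dThree K g V c x y z w := by
      simp only [dThree, LinearMap.smul_apply, lie_smul, smul_add, smul_sub]
    rw [h, hc.2, smul_zero]

/-- The 3-coboundaries `d(C²(g, V))`, as a subspace of `Z³(g, V)`. -/
def threeCoboundary : Submodule K (threeCocycle K g V) :=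
  (LinearMap.range (d₂₃ K g V)).comap (threeCocycle K g V).subtype

/-- `H³(g, V)`. -/
abbrev LieH3 := threeCocycle K g V ⧸ threeCoboundary K g V

/-- The cohomology class of a 3-cocycle. -/
def LieH3.mk (c : threeCocycle K g V) : LieH3 K g V := (threeCoboundary K g V).mkQ c

end Cohomology

/-! ## Crossed modules of Lie algebras -/

/-- A homomorphism `μ : m → n` of Lie algebras together with an action of `n` on `m` by
derivations is a crossed module. -/
structure IsLieCrossedModule {K : Type*} [CommRing K] {m n : Type*} [LieRing m] [LieAlgebra K m]
    [LieRing n] [LieAlgebra K n] (μ : m →ₗ⁅K⁆ n) (act : n →ₗ⁅K⁆ LieDerivation K m m) : Prop where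
  map_act : ∀ (a : n) (x : m), μ (act a x) = ⁅a, μ x⁆
  act_map : ∀ x y : m, act (μ x) y = ⁅x, y⁆

/-- A crossed module `μ : m → n` together with an exact sequence `0 → V → m → n → g → 0`
identifying `ker μ` with `V` (as `g`-modules) and `coker μ` with `g` (as Lie algebras). -/
structure CrossedExtension (K : Type*) [CommRing K] (g : Type u) [LieRing g] [LieAlgebra K g]
    (V : Type*) [AddCommGroup V] [Module K V] [LieRingModule g V] [LieModule K g V] where
  m : Type u
  n : Type u
  [lieRingM : LieRing m]
  [lieAlgebraM : LieAlgebra K m]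
  [lieRingN : LieRing n]
  [lieAlgebraN : LieAlgebra K n]
  /-- the crossed module -/
  μ : m →ₗ⁅K⁆ n
  /-- the action of `n` on `m` -/
  act : n →ₗ⁅K⁆ LieDerivation K m m
  isCrossed : IsLieCrossedModule μ act
  /-- the inclusion of the kernel -/
  incl : V →ₗ[K] m
  /-- the projection to the cokernel -/
  proj : n →ₗ⁅K⁆ g
  incl_injective : Function.Injective incl
  exact_m : Function.Exact incl μ
  exact_n : Function.Exact μ proj
  proj_surjective : Function.Surjective proj
  act_incl : ∀ (a : n) (w : V), act a (incl w) = incl ⁅proj a, w⁆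

namespace CrossedExtension

attribute [instance] lieRingM lieAlgebraM lieRingN lieAlgebraN

variable {K : Type*} [CommRing K] {g : Type u} [LieRing g] [LieAlgebra K g]
  {V : Type*} [AddCommGroup V] [Module K V] [LieRingModule g V] [LieModule K g V]

/-- A morphism of crossed modules which induces the identity on the kernel `V` and on the
cokernel `g`. -/
structure Hom (X Y : CrossedExtension K g V) where
  φ : X.m →ₗ⁅K⁆ Y.m
  ψ : X.n →ₗ⁅K⁆ Y.n
  comm : ∀ x, Y.μ (φ x) = ψ (X.μ x)
  equivariant : ∀ a x, φ (X.act a x) = Y.act (ψ a) (φ x)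
  comm_incl : ∀ w, φ (X.incl w) = Y.incl w
  comm_proj : ∀ a, Y.proj (ψ a) = X.proj a

/-- Equivalence of crossed modules with kernel `V` and cokernel `g`: the equivalence relation
generated by the existence of a morphism. -/
def Equivalent : CrossedExtension K g V → CrossedExtension K g V → Prop :=
  Relation.EqvGen fun X Y => Nonempty (Hom X Y)

/-- `γ` is a 3-cocycle associated to the crossed module `X`: for some linear section `ρ` of the
projection and some alternating bilinear `β` with `μ(β(x, y)) = [ρ x, ρ y] - ρ [x, y]`, the
inclusion of `V` composed with `γ` is the formal Chevalley-Eilenberg coboundary of `β`. -/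
def IsAssociatedCocycle (X : CrossedExtension K g V) (γ : threeCocycle K g V) : Prop :=
  ∃ (ρ : g →ₗ[K] X.n) (β : twoCochain K g X.m),
    (∀ x, X.proj (ρ x) = x) ∧
    (∀ x y, X.μ (β x y) = ⁅ρ x, ρ y⁆ - ρ ⁅x, y⁆) ∧
    ∀ x y z, X.incl (γ.1 x y z) =
      X.act (ρ x) (β y z) - X.act (ρ y) (β x z) + X.act (ρ z) (β x y)
        - β ⁅x, y⁆ z + β ⁅x, z⁆ y - β ⁅y, z⁆ x

/-- `c ∈ H³(g, V)` is the class of a 3-cocycle associated to `X`. -/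
def Represents (X : CrossedExtension K g V) (c : LieH3 K g V) : Prop :=
  ∃ γ : threeCocycle K g V, X.IsAssociatedCocycle γ ∧ LieH3.mk K g V γ = c

end CrossedExtension

/-! ## Yoneda products -/

section Yoneda

/-- The abelian Lie algebra on a vector space. -/
abbrev abelianLieRing (V : Type*) [AddCommGroup V] : LieRing V where
  bracket _ _ := 0
  add_lie _ _ _ := by simp
  lie_add _ _ _ := by simp
  lie_self _ := rfl
  leibniz_lie _ _ _ := by simp

/-- A type synonym of a vector space, seen as an abelian Lie algebra. -/
def AbelianLie (V : Type*) := V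

instance (V : Type*) [AddCommGroup V] : LieRing (AbelianLie V) := abelianLieRing V
instance (K V : Type*) [CommRing K] [AddCommGroup V] [Module K V] : LieAlgebra K (AbelianLie V) where
  toModule := (inferInstance : Module K V)
  lie_smul t _ _ := (smul_zero (A := V) t).symm

theorem AbelianLie.bracket_eq_zero {V : Type*} [AddCommGroup V] (x y : AbelianLie V) :
    ⁅x, y⁆ = 0 := rfl

variable {K : Type*} [CommRing K] {g : Type u} [LieRing g] [LieAlgebra K g]
  {V₁ : Type*} [AddCommGroup V₁] [Module K V₁] [LieRingModule g V₁] [LieModule K g V₁]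
  {V₂ : Type u} [AddCommGroup V₂] [Module K V₂] [LieRingModule g V₂] [LieModule K g V₂]
  {V₃ : Type u} [AddCommGroup V₃] [Module K V₃] [LieRingModule g V₃] [LieModule K g V₃]

/-- The action of the abelian extension of `g` by `V₃` on the abelian Lie algebra `V₂`
through `g`. -/
def yonedaAct (V₂ : Type u) [AddCommGroup V₂] [Module K V₂] [LieRingModule g V₂]
    [LieModule K g V₂] (α : twoCocycle K g V₃) :
    LieAlgebra.ofTwoCocycle α →ₗ⁅K⁆ LieDerivation K (AbelianLie V₂) (AbelianLie V₂) where
  toFun a :=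
    { toFun := fun x => LieModule.toEnd K g V₂ a.carrier.1 x
      map_add' := fun x y => lie_add (M := V₂) a.carrier.1 x y
      map_smul' := fun t x => lie_smul (M := V₂) t a.carrier.1 x
      leibniz' := fun x y => by
        simp only [AbelianLie.bracket_eq_zero]
        rw [sub_zero]
        exact lie_zero (M := V₂) a.carrier.1 }
  map_add' a b := by
    ext x
    exact add_lie (M := V₂) a.carrier.1 b.carrier.1 x
  map_smul' t a := by
    ext x
    exact smul_lie (M := V₂) t a.carrier.1 x
  map_lie' {a b} := by
    ext x
    rw [LieDerivation.commutator_apply]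
    exact lie_lie (M := V₂) a.carrier.1 b.carrier.1 x

/-- The Yoneda product `0 → V₁ → V₂ → V₃ ×_α g → g → 0` of a short exact sequence
`0 → V₁ → V₂ → V₃ → 0` of `g`-modules with the abelian extension of `g` by `V₃` defined by a
2-cocycle `α`. Here `V₂` is an abelian Lie algebra, on which the extension acts through `g`. -/
def yonedaProduct (i : V₁ →ₗ⁅K, g⁆ V₂) (d : V₂ →ₗ⁅K, g⁆ V₃) (hi : Function.Injective i)
    (hex : Function.Exact i d) (hd : Function.Surjective d) (α : twoCocycle K g V₃) :
    CrossedExtension K g V₁ where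
  m := AbelianLie V₂
  n := LieAlgebra.ofTwoCocycle α
  μ :=
    { toFun := fun x => LieAlgebra.ofProd α (0, d x)
      map_add' := fun x y => by
        rw [← LieAlgebra.of_add]
        exact congrArg _ (Prod.ext (by simp) (map_add d x y))
      map_smul' := fun t x => by
        rw [RingHom.id_apply, ← LieAlgebra.of_smul]
        exact congrArg _ (Prod.ext (by simp) (map_smul d t x))
      map_lie' := fun {x y} => by
        rw [LieAlgebra.bracket_ofTwoCocycle, AbelianLie.bracket_eq_zero]
        refine congrArg _ (Prod.ext (by simp) ?_)
        simp only [Equiv.symm_apply_apply, zero_lie, map_zero, add_zero, sub_zero]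
        exact map_zero d }
  act := yonedaAct V₂ α
  isCrossed :=
    { map_act := fun a x => by
        change LieAlgebra.ofProd α (0, d ⁅a.carrier.1, (x : V₂)⁆) =
          ⁅a, LieAlgebra.ofProd α (0, d x)⁆
        rw [LieAlgebra.bracket_ofTwoCocycle]
        refine congrArg _ (Prod.ext (by simp) ?_)
        simp only [Equiv.symm_apply_apply, zero_lie, map_zero, zero_add, sub_zero]
        exact LieModuleHom.map_lie d _ _
      act_map := fun x y => zero_lie (M := V₂) (L := g) y }
  incl := (i : V₁ →ₗ[K] V₂)
  proj :=
    { toFun := fun a => a.carrier.1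
      map_add' := fun _ _ => rfl
      map_smul' := fun _ _ => rfl
      map_lie' := rfl }
  incl_injective := hi
  exact_m := fun x => by
    refine Iff.trans ⟨fun h => ?_, fun h => ?_⟩ (hex x)
    · exact congrArg (fun a : LieAlgebra.ofTwoCocycle α => a.carrier.2) h
    · exact congrArg (fun v => LieAlgebra.ofProd α (0, v)) h
  exact_n := fun a => by
    constructor
    · intro h
      obtain ⟨x, hx⟩ := hd a.carrier.2
      refine ⟨x, ?_⟩
      change LieAlgebra.ofProd α (0, d x) = LieAlgebra.ofProd α a.carrier
      exact congrArg _ (Prod.ext h.symm hx)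
    · rintro ⟨x, rfl⟩
      rfl
  proj_surjective := fun x => ⟨LieAlgebra.ofProd α (x, 0), rfl⟩
  act_incl := fun a w => (LieModuleHom.map_lie i _ _).symm

end Yoneda

/-! ## The universal enveloping algebra and the augmentation sequence -/

namespace Env

variable (g : Type u) [LieRing g] [LieAlgebra ℂ g]

/-- The universal enveloping algebra `Ug`. -/
abbrev U := UniversalEnvelopingAlgebra ℂ g

/-- The canonical map `g → Ug`. -/
abbrev inc : g →ₗ⁅ℂ⁆ U g := UniversalEnvelopingAlgebra.ι ℂ

/-- The augmentation `ε : Ug → ℂ`. -/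
def counit : U g →ₐ[ℂ] ℂ := UniversalEnvelopingAlgebra.lift ℂ (0 : g →ₗ⁅ℂ⁆ ℂ)

/-- The coproduct of `Ug`: the algebra map for which the elements of `g` are primitive. -/
def comul : U g →ₐ[ℂ] U g ⊗[ℂ] U g :=
  UniversalEnvelopingAlgebra.lift ℂ
    { toFun := fun x => inc g x ⊗ₜ[ℂ] 1 + 1 ⊗ₜ[ℂ] inc g x
      map_add' := fun x y => by
        simp only [map_add, TensorProduct.add_tmul, TensorProduct.tmul_add]
        abel
      map_smul' := fun t x => by
        simp only [map_smul, RingHom.id_apply, smul_add, TensorProduct.smul_tmul',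
          TensorProduct.tmul_smul]
      map_lie' := fun {x y} => by
        simp only [LieHom.map_lie, LieRing.of_associative_ring_bracket, mul_add, add_mul,
          Algebra.TensorProduct.tmul_mul_tmul, mul_one, one_mul, TensorProduct.sub_tmul,
          TensorProduct.tmul_sub]
        abel }

variable {g}

theorem counit_inc (x : g) : counit g (inc g x) = 0 := by
  exact UniversalEnvelopingAlgebra.lift_ι_apply ℂ (0 : g →ₗ⁅ℂ⁆ ℂ) x

theorem comul_inc (x : g) : comul g (inc g x) = inc g x ⊗ₜ[ℂ] 1 + 1 ⊗ₜ[ℂ] inc g x :=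
  UniversalEnvelopingAlgebra.lift_ι_apply ℂ _ x

variable (g)

/-- The augmentation ideal `Ug⁺`. -/
def augIdeal : Submodule ℂ (U g) := LinearMap.ker (counit g).toLinearMap

/-- Right multiplication by an element of `g` on `Ug`. -/
def rightMul (x : g) : U g →ₗ[ℂ] U g := LinearMap.mulRight ℂ (inc g x)

theorem rightMul_mem_augIdeal (x : g) (a : U g) (_ : a ∈ augIdeal g) :
    rightMul g x a ∈ augIdeal g := by
  change counit g (a * inc g x) = 0
  rw [map_mul, counit_inc, mul_zero]

/-- Right multiplication by an element of `g` on `Ug⁺`. -/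
def rightMulAug (x : g) : augIdeal g →ₗ[ℂ] augIdeal g :=
  (rightMul g x).restrict (rightMul_mem_augIdeal g x)

/-- The full linear dual `(Ug)^∨`, with the `g`-action `(x · φ)(a) = φ (a x)`. -/
def UDual := Module.Dual ℂ (U g)

instance : AddCommGroup (UDual g) := inferInstanceAs (AddCommGroup (Module.Dual ℂ (U g)))
instance : Module ℂ (UDual g) := inferInstanceAs (Module ℂ (Module.Dual ℂ (U g)))
instance : FunLike (UDual g) (U g) ℂ := inferInstanceAs (FunLike (Module.Dual ℂ (U g)) (U g) ℂ)
instance : LinearMapClass (UDual g) ℂ (U g) ℂ :=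
  inferInstanceAs (LinearMapClass (Module.Dual ℂ (U g)) ℂ (U g) ℂ)

/-- The full linear dual `(Ug⁺)^∨`, with the `g`-action `(x · φ)(a) = φ (a x)`. -/
def AugDual := Module.Dual ℂ (augIdeal g)

instance : AddCommGroup (AugDual g) := inferInstanceAs (AddCommGroup (Module.Dual ℂ (augIdeal g)))
instance : Module ℂ (AugDual g) := inferInstanceAs (Module ℂ (Module.Dual ℂ (augIdeal g)))
instance : FunLike (AugDual g) (augIdeal g) ℂ :=
  inferInstanceAs (FunLike (Module.Dual ℂ (augIdeal g)) (augIdeal g) ℂ)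
instance : LinearMapClass (AugDual g) ℂ (augIdeal g) ℂ :=
  inferInstanceAs (LinearMapClass (Module.Dual ℂ (augIdeal g)) ℂ (augIdeal g) ℂ)

variable {g}

@[ext] theorem UDual.ext {φ ψ : UDual g} (h : ∀ a, φ a = ψ a) : φ = ψ := DFunLike.ext _ _ h
@[ext] theorem AugDual.ext {φ ψ : AugDual g} (h : ∀ a, φ a = ψ a) : φ = ψ := DFunLike.ext _ _ h
@[simp] theorem UDual.add_apply (φ ψ : UDual g) (a : U g) : (φ + ψ) a = φ a + ψ a := rfl
@[simp] theorem UDual.smul_apply (t : ℂ) (φ : UDual g) (a : U g) : (t • φ) a = t * φ a := rfl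
@[simp] theorem AugDual.add_apply (φ ψ : AugDual g) (a : augIdeal g) :
    (φ + ψ) a = φ a + ψ a := rfl
@[simp] theorem AugDual.smul_apply (t : ℂ) (φ : AugDual g) (a : augIdeal g) :
    (t • φ) a = t * φ a := rfl

theorem rightMul_lie (x y : g) (a : U g) :
    rightMul g ⁅x, y⁆ a = rightMul g y (rightMul g x a) - rightMul g x (rightMul g y a) := by
  simp only [rightMul, LinearMap.mulRight_apply, LieHom.map_lie,
    LieRing.of_associative_ring_bracket, mul_sub, mul_assoc]

theorem rightMul_add (x y : g) (a : U g) :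
    rightMul g (x + y) a = rightMul g x a + rightMul g y a := by
  simp only [rightMul, LinearMap.mulRight_apply, map_add, mul_add]

theorem rightMul_smul (t : ℂ) (x : g) (a : U g) :
    rightMul g (t • x) a = t • rightMul g x a := by
  simp only [rightMul, LinearMap.mulRight_apply, map_smul, mul_smul_comm]

instance : LieRingModule g (UDual g) where
  bracket x φ := LinearMap.comp (show Module.Dual ℂ (U g) from φ) (rightMul g x)
  add_lie x y φ := by
    ext a
    change φ (rightMul g (x + y) a) = φ (rightMul g x a) + φ (rightMul g y a)
    rw [rightMul_add, map_add]
  lie_add x φ ψ := rfl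
  leibniz_lie x y φ := by
    ext a
    change φ (rightMul g y (rightMul g x a)) =
      φ (rightMul g ⁅x, y⁆ a) + φ (rightMul g x (rightMul g y a))
    rw [rightMul_lie, map_sub, sub_add_cancel]

theorem UDual.lie_apply (x : g) (φ : UDual g) (a : U g) : ⁅x, φ⁆ a = φ (a * inc g x) := rfl

instance : LieModule ℂ g (UDual g) where
  smul_lie t x φ := by
    ext a
    change φ (rightMul g (t • x) a) = t * φ (rightMul g x a)
    rw [rightMul_smul, map_smul, smul_eq_mul]
  lie_smul t x φ := rfl

instance : LieRingModule g (AugDual g) where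
  bracket x φ := LinearMap.comp (show Module.Dual ℂ (augIdeal g) from φ) (rightMulAug g x)
  add_lie x y φ := by
    ext a
    change φ (rightMulAug g (x + y) a) = φ (rightMulAug g x a) + φ (rightMulAug g y a)
    rw [← map_add]
    exact congrArg φ (Subtype.ext (rightMul_add x y a))
  lie_add x φ ψ := rfl
  leibniz_lie x y φ := by
    ext a
    change φ (rightMulAug g y (rightMulAug g x a)) =
      φ (rightMulAug g ⁅x, y⁆ a) + φ (rightMulAug g x (rightMulAug g y a))
    rw [← map_add]
    refine congrArg φ (Subtype.ext ?_)
    change rightMul g y (rightMul g x a) = rightMul g ⁅x, y⁆ a + rightMul g x (rightMul g y a)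
    rw [rightMul_lie, sub_add_cancel]

theorem AugDual.lie_apply (x : g) (φ : AugDual g) (a : augIdeal g) :
    ⁅x, φ⁆ a = φ ⟨a * inc g x, rightMul_mem_augIdeal g x a a.2⟩ := rfl

instance : LieModule ℂ g (AugDual g) where
  smul_lie t x φ := by
    ext a
    change φ (rightMulAug g (t • x) a) = t * φ (rightMulAug g x a)
    rw [← smul_eq_mul, ← map_smul]
    exact congrArg φ (Subtype.ext (rightMul_smul t x a))
  lie_smul t x φ := rfl

variable (g)

/-- The trivial `g`-module `ℂ`. -/
abbrev Triv := TrivialLieModule ℂ g ℂ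

/-- The underlying complex number of an element of the trivial module. -/
def Triv.val : Triv g ≃ₗ[ℂ] ℂ := TrivialLieModule.equiv ℂ g ℂ

/-- The dual `ℂ → (Ug)^∨`, `z ↦ z ε`, of the augmentation. -/
def augIncl : Triv g →ₗ⁅ℂ, g⁆ UDual g where
  toFun z := (Triv.val g z • (counit g).toLinearMap : Module.Dual ℂ (U g))
  map_add' z w := by rw [map_add, add_smul]; rfl
  map_smul' t z := by rw [map_smul, smul_assoc]; rfl
  map_lie' {x z} := by
    ext a
    change Triv.val g ⁅x, z⁆ * counit g a = Triv.val g z * counit g (a * inc g x)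
    rw [trivial_lie_zero, map_zero, zero_mul, map_mul, counit_inc, mul_zero, mul_zero]

/-- The restriction map `(Ug)^∨ → (Ug⁺)^∨`. -/
def augRestrict : UDual g →ₗ⁅ℂ, g⁆ AugDual g where
  toFun φ := LinearMap.comp (show Module.Dual ℂ (U g) from φ) (augIdeal g).subtype
  map_add' _ _ := rfl
  map_smul' _ _ := rfl
  map_lie' := rfl

theorem augIncl_injective : Function.Injective (augIncl g) := by
  intro z w h
  have h1 : Triv.val g z * counit g 1 = Triv.val g w * counit g 1 :=
    congrArg (fun φ : UDual g => φ 1) h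
  rw [map_one, mul_one, mul_one] at h1
  exact (Triv.val g).injective h1

theorem augRestrict_surjective : Function.Surjective (augRestrict g) := by
  intro φ
  obtain ⟨ψ, hψ⟩ := LinearMap.exists_extend (show Module.Dual ℂ (augIdeal g) from φ)
  exact ⟨ψ, hψ⟩

theorem aug_exact : Function.Exact (augIncl g) (augRestrict g) := by
  intro φ
  constructor
  · intro h
    refine ⟨(Triv.val g).symm (φ 1), ?_⟩
    ext a
    change Triv.val g ((Triv.val g).symm (φ 1)) * counit g a = φ a
    rw [LinearEquiv.apply_symm_apply]
    have hm : a - counit g a • (1 : U g) ∈ augIdeal g := by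
      change counit g (a - counit g a • (1 : U g)) = 0
      rw [map_sub, map_smul, map_one, smul_eq_mul, mul_one, sub_self]
    have h0 : φ (a - counit g a • (1 : U g)) = 0 :=
      congrArg (fun χ : AugDual g => χ ⟨_, hm⟩) h
    rw [map_sub, map_smul, smul_eq_mul, sub_eq_zero] at h0
    rw [h0, mul_comm]
  · rintro ⟨z, rfl⟩
    ext a
    change Triv.val g z * counit g a.1 = 0
    rw [show counit g a.1 = 0 from a.2, mul_zero]

/-- The Yoneda product `0 → ℂ → (Ug)^∨ → (Ug⁺)^∨ ×_α g → g → 0` of the augmentation sequence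
with the abelian extension defined by `α`. -/
def augYoneda (α : twoCocycle ℂ g (AugDual g)) : CrossedExtension ℂ g (Triv g) :=
  yonedaProduct (augIncl g) (augRestrict g) (augIncl_injective g) (aug_exact g)
    (augRestrict_surjective g) α

/-! ## Convolution, Eulerian idempotent, and the lift of a 3-cocycle -/

variable {g}

/-- The convolution product on `End(Ug)`. -/
def conv (p q : U g →ₗ[ℂ] U g) : U g →ₗ[ℂ] U g :=
  LinearMap.mul' ℂ (U g) ∘ₗ TensorProduct.map p q ∘ₗ (comul g).toLinearMap

variable (g)

/-- The unit `η ε` of the convolution product. -/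
def convOne : U g →ₗ[ℂ] U g := Algebra.linearMap ℂ (U g) ∘ₗ (counit g).toLinearMap

variable {g}

/-- Convolution powers. -/
def convPow (p : U g →ₗ[ℂ] U g) : ℕ → (U g →ₗ[ℂ] U g)
  | 0 => convOne g
  | k + 1 => conv p (convPow p k)

/-- The pointwise sum of a sequence of endomorphisms of `Ug` which is pointwise eventually zero. -/
def locSum (w : ℕ → (U g →ₗ[ℂ] U g)) (hw : ∀ a, {k | w k a ≠ 0}.Finite) : U g →ₗ[ℂ] U g where
  toFun a := ∑ᶠ k, w k a
  map_add' a b := by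
    simp only [map_add]
    exact finsum_add_distrib (hw a) (hw b)
  map_smul' t a := by
    simp only [map_smul, RingHom.id_apply]
    exact (smul_finsum' t (hw a)).symm

/-- `p` vanishes on all products of fewer than `k` elements of `g`. -/
def VanishesBelow (k : ℕ) (p : U g →ₗ[ℂ] U g) : Prop :=
  ∀ l : List g, l.length < k → p (l.map (inc g)).prod = 0

theorem comul_rightMul (x : g) (a : U g) :
    comul g (rightMul g x a) = TensorProduct.map (rightMul g x) LinearMap.id (comul g a) +
      TensorProduct.map LinearMap.id (rightMul g x) (comul g a) := by
  change comul g (a * inc g x) = _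
  rw [map_mul, comul_inc]
  induction comul g a using TensorProduct.induction_on with
  | zero => simp
  | tmul b c => simp [mul_add, rightMul]
  | add b c hb hc => rw [add_mul, hb, hc, map_add, map_add]; abel

theorem conv_rightMul (p q : U g →ₗ[ℂ] U g) (x : g) (a : U g) :
    conv p q (rightMul g x a) =
      conv (p ∘ₗ rightMul g x) q a + conv p (q ∘ₗ rightMul g x) a := by
  simp only [conv, LinearMap.comp_apply, AlgHom.toLinearMap_apply, comul_rightMul, map_add]
  congr 2
  · rw [← LinearMap.comp_apply, ← TensorProduct.map_comp, LinearMap.comp_id]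
  · rw [← LinearMap.comp_apply, ← TensorProduct.map_comp, LinearMap.comp_id]

theorem VanishesBelow.comp_rightMul {k : ℕ} {p : U g →ₗ[ℂ] U g} (hp : VanishesBelow k p) (x : g) :
    VanishesBelow (k - 1) (p ∘ₗ rightMul g x) := by
  intro l hl
  have := hp (l ++ [x]) (by simp; omega)
  simpa [rightMul] using this

theorem VanishesBelow.conv {i j : ℕ} {p q : U g →ₗ[ℂ] U g} (hp : VanishesBelow i p)
    (hq : VanishesBelow j q) : VanishesBelow (i + j) (conv p q) := by
  intro l
  induction l using List.reverseRecOn generalizing i j p q with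
  | nil =>
    intro h
    have h1 : Env.conv p q 1 = p 1 * q 1 := by
      simp [Env.conv, Algebra.TensorProduct.one_def]
    simp only [List.map_nil, List.prod_nil, h1]
    rcases Nat.eq_zero_or_pos i with hi | hi
    · have := hq [] (by simp at h ⊢; omega)
      simp only [List.map_nil, List.prod_nil] at this
      rw [this, mul_zero]
    · have := hp [] (by simpa using hi)
      simp only [List.map_nil, List.prod_nil] at this
      rw [this, zero_mul]
  | append_singleton l x ih =>
    intro h
    have h2 : ((l ++ [x]).map (inc g)).prod = rightMul g x (l.map (inc g)).prod := by
      simp [rightMul]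
    simp only [List.length_append, List.length_singleton] at h
    rw [h2, conv_rightMul, ih (hp.comp_rightMul x) hq (by omega),
      ih hp (hq.comp_rightMul x) (by omega), add_zero]

theorem VanishesBelow.convPow {p : U g →ₗ[ℂ] U g} (hp : VanishesBelow 1 p) (k : ℕ) :
    VanishesBelow k (convPow p k) := by
  induction k with
  | zero => intro l hl; simp at hl
  | succ k ih =>
    rw [add_comm]
    have h := hp.conv ih
    rwa [add_comm] at h ⊢

theorem span_products :
    Submodule.span ℂ (Set.range fun l : List g => (l.map (inc g)).prod) = ⊤ := by
  have h1 : Algebra.adjoin ℂ (Set.range (inc g)) = ⊤ := by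
    set S := Algebra.adjoin ℂ (Set.range (inc g))
    let j : g →ₗ⁅ℂ⁆ S :=
      { toFun := fun x => ⟨inc g x, Algebra.subset_adjoin ⟨x, rfl⟩⟩
        map_add' := fun x y => Subtype.ext (map_add (inc g) x y)
        map_smul' := fun t x => Subtype.ext (map_smul (inc g) t x)
        map_lie' := fun {x y} => Subtype.ext (LieHom.map_lie (inc g) x y) }
    have h2 : S.val.comp (UniversalEnvelopingAlgebra.lift ℂ j) = AlgHom.id ℂ (U g) := by
      apply UniversalEnvelopingAlgebra.hom_ext
      ext x
      change ((UniversalEnvelopingAlgebra.lift ℂ j (inc g x) : S) : U g) = inc g x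
      rw [UniversalEnvelopingAlgebra.lift_ι_apply]
      rfl
    rw [eq_top_iff]
    intro a _
    have h3 := DFunLike.congr_fun h2 a
    rw [AlgHom.id_apply] at h3
    rw [← h3]
    exact Subtype.property _
  rw [eq_top_iff, ← Algebra.top_toSubmodule, ← h1, Algebra.adjoin_eq_span]
  refine Submodule.span_mono ?_
  intro a ha
  obtain ⟨l, hl, rfl⟩ := Submonoid.exists_list_of_mem_closure ha
  clear ha
  induction l with
  | nil => exact ⟨[], rfl⟩
  | cons b l ih =>
    obtain ⟨x, rfl⟩ := hl b (by simp)
    obtain ⟨l', hl'⟩ := ih fun c hc => hl c (by simp [hc])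
    exact ⟨x :: l', by simpa using congrArg (inc g x * ·) hl'⟩

theorem finite_of_vanishesBelow {w : ℕ → (U g →ₗ[ℂ] U g)} (hw : ∀ k, VanishesBelow k (w k))
    (a : U g) : {k | w k a ≠ 0}.Finite := by
  have ha : a ∈ Submodule.span ℂ (Set.range fun l : List g => (l.map (inc g)).prod) := by
    rw [span_products]; trivial
  induction ha using Submodule.span_induction with
  | mem a h =>
    obtain ⟨l, rfl⟩ := h
    refine (Set.finite_Iic l.length).subset fun k hk => ?_
    by_contra hlt
    exact hk (hw k l (by simpa using hlt))
  | zero => simp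
  | add a b _ _ iha ihb =>
    refine (iha.union ihb).subset fun k hk => ?_
    by_contra hn
    simp only [Set.mem_union, Set.mem_ofPred_eq, not_or, not_not] at hn
    exact hk (by rw [map_add, hn.1, hn.2, add_zero])
  | smul t a _ iha =>
    refine iha.subset fun k hk h0 => hk ?_
    rw [map_smul, h0, smul_zero]

theorem VanishesBelow.smul {k : ℕ} {p : U g →ₗ[ℂ] U g} (hp : VanishesBelow k p) (t : ℂ) :
    VanishesBelow k (t • p) := fun l hl => by
  rw [LinearMap.smul_apply, hp l hl, smul_zero]

variable (g)

/-- `Id - η ε`. -/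
def redId : U g →ₗ[ℂ] U g := LinearMap.id - convOne g

theorem vanishesBelow_redId : VanishesBelow 1 (redId g) := by
  intro l hl
  obtain rfl : l = [] := by simpa using hl
  simp [redId, convOne]

theorem locFin_pr (a : U g) :
    {k : ℕ | ((((-1 : ℂ) ^ k / (k + 1)) • convPow (redId g) (k + 1)) a) ≠ 0}.Finite := by
  refine finite_of_vanishesBelow (w := fun k : ℕ =>
    ((-1 : ℂ) ^ k / (k + 1)) • convPow (redId g) (k + 1)) (fun k => ?_) a
  have h : VanishesBelow k (convPow (redId g) (k + 1)) :=
    fun l hl => (vanishesBelow_redId g).convPow (k + 1) l (by omega)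
  exact h.smul _

/-- The Eulerian idempotent `pr = ∑ (-1)^k / (k + 1) (Id - η ε)^{⋆ (k + 1)}`, that is the
convolution logarithm of the identity. -/
def pr : U g →ₗ[ℂ] U g :=
  locSum (fun k : ℕ => ((-1 : ℂ) ^ k / (k + 1)) • convPow (redId g) (k + 1)) (locFin_pr g)

theorem vanishesBelow_pr : VanishesBelow 1 (pr g) := by
  intro l hl
  change ∑ᶠ k : ℕ, (((-1 : ℂ) ^ k / (k + 1)) • convPow (redId g) (k + 1)) _ = 0
  refine (finsum_congr fun k => ?_).trans finsum_zero
  exact ((vanishesBelow_redId g).convPow (k + 1)).smul ((-1 : ℂ) ^ k / ((k : ℂ) + 1)) l (by omega)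

theorem locFin_phi (t : ℂ) (a : U g) :
    {n : ℕ | (((t ^ n / (n.factorial : ℂ)) • convPow (pr g) n) a) ≠ 0}.Finite :=
  finite_of_vanishesBelow (fun n => ((vanishesBelow_pr g).convPow n).smul _) a

/-- `φ_t = ∑ tⁿ / n! pr^{⋆ n}`. -/
def phi (t : ℂ) : U g →ₗ[ℂ] U g :=
  locSum (fun n : ℕ => (t ^ n / (n.factorial : ℂ)) • convPow (pr g) n) (locFin_phi g t)

theorem exists_toLie : ∃ p : U g →ₗ[ℂ] g, ∀ x, inc g (p (inc g x)) = inc g x := by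
  obtain ⟨s, hs⟩ := (inc g : g →ₗ[ℂ] U g).rangeRestrict.exists_rightInverse_of_surjective
    (LinearMap.range_rangeRestrict _)
  obtain ⟨p, hp⟩ := LinearMap.exists_extend s
  refine ⟨p, fun x => ?_⟩
  have h1 : p (inc g x) = s ((inc g : g →ₗ[ℂ] U g).rangeRestrict x) :=
    DFunLike.congr_fun hp ((inc g : g →ₗ[ℂ] U g).rangeRestrict x)
  rw [h1]
  exact congrArg Subtype.val
    (DFunLike.congr_fun hs ((inc g : g →ₗ[ℂ] U g).rangeRestrict x))

/-- The inverse of the identification of `g` with its image in `Ug` (extended linearly, in an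
arbitrary way, outside of that image; it is only applied to elements of the image of `g`). -/
def toLie : U g →ₗ[ℂ] g := (exists_toLie g).choose

theorem inc_toLie (x : g) : inc g (toLie g (inc g x)) = inc g x := (exists_toLie g).choose_spec x

variable {g}

/-- `A_t(a, x) = ∑ φ_{-t}(a⁽¹⁾) φ_t(a⁽²⁾ x)`, as an element of `g`. -/
def A (t : ℂ) (x : g) : U g →ₗ[ℂ] g := toLie g ∘ₗ conv (phi g (-t)) (phi g t ∘ₗ rightMul g x)

variable (g)

/-- The iterated coproduct `a ↦ ∑ a⁽¹⁾ ⊗ (a⁽²⁾ ⊗ a⁽³⁾)`. -/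
def comul₃ : U g →ₗ[ℂ] U g ⊗[ℂ] (U g ⊗[ℂ] U g) :=
  TensorProduct.map LinearMap.id (comul g).toLinearMap ∘ₗ (comul g).toLinearMap

variable {g}

/-- The linear map `g ⊗ (g ⊗ g) → ℂ` given by a trilinear map. -/
def triLift (f : g →ₗ[ℂ] g →ₗ[ℂ] g →ₗ[ℂ] Triv g) : g ⊗[ℂ] (g ⊗[ℂ] g) →ₗ[ℂ] ℂ :=
  (Triv.val g).toLinearMap ∘ₗ
    TensorProduct.lift (TensorProduct.uncurry (RingHom.id ℂ) g g (Triv g) ∘ₗ f)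

/-- `∑ ∫₀¹ f(pr(a⁽¹⁾), A_t(a⁽²⁾, x), A_t(a⁽³⁾, y)) dt`. -/
def alphaTilde (f : g →ₗ[ℂ] g →ₗ[ℂ] g →ₗ[ℂ] Triv g) (a : U g) (x y : g) : ℂ :=
  ∫ t in (0 : ℝ)..1, triLift f
    (TensorProduct.map (toLie g ∘ₗ pr g) (TensorProduct.map (A (t : ℂ) x) (A (t : ℂ) y))
      (comul₃ g a))

/-- The cochain `α` of `g` with values in `(Ug⁺)^∨` is given by the formula
`α(a, x, y) = ∑ ∫₀¹ f(pr(a⁽¹⁾), A_t(a⁽²⁾, x), A_t(a⁽³⁾, y)) dt`, for `a ∈ Ug⁺`. -/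
def IsLiftOf (α : twoCocycle ℂ g (AugDual g)) (f : threeCocycle ℂ g (Triv g)) : Prop :=
  ∀ (x y : g) (a : augIdeal g), (α.1 x y) a = alphaTilde f.1 a x y

/-! ## The Cartan cocycle -/

variable (g)

/-- The Cartan cocycle `(x, y, z) ↦ κ([x, y], z)`, where `κ` is the Killing form. -/
def cartanCocycle : threeCocycle ℂ g (Triv g) :=
  ⟨LinearMap.mk₂ ℂ (fun x y => (Triv.val g).symm.toLinearMap ∘ₗ killingForm ℂ g ⁅x, y⁆)
      (fun x x' y => by ext z; simp) (fun t x y => by ext z; simpa using map_smul (Triv.val g).symm t _)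
      (fun x y y' => by ext z; simp) (fun t x y => by ext z; simpa using map_smul (Triv.val g).symm t _), by
    have hinv : ∀ x y z : g, killingForm ℂ g ⁅x, y⁆ z = killingForm ℂ g x ⁅y, z⁆ :=
      LieModule.traceForm_apply_lie_apply ℂ g g
    refine ⟨⟨fun x y => ?_, fun x y => ?_⟩, fun x y z w => ?_⟩
    · simp
    · simp [hinv]
    · simp only [dThree, LinearMap.mk₂_apply, LinearMap.comp_apply, LinearEquiv.coe_coe,
        trivial_lie_zero, sub_zero, add_zero, zero_sub, ← map_neg, ← map_sub, ← map_add]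
      rw [LinearEquiv.map_eq_zero_iff]
      have h1 : killingForm ℂ g ⁅⁅x, y⁆, z⁆ w = killingForm ℂ g ⁅⁅x, z⁆, y⁆ w
          - killingForm ℂ g ⁅⁅y, z⁆, x⁆ w := by
        rw [← LinearMap.sub_apply, ← map_sub]
        congr 2
        rw [lie_lie x y z, ← lie_skew ⁅x, z⁆ y, ← lie_skew ⁅y, z⁆ x]
        abel
      have h2 : killingForm ℂ g ⁅⁅x, w⁆, y⁆ z - killingForm ℂ g ⁅⁅y, w⁆, x⁆ z =
          killingForm ℂ g ⁅⁅x, y⁆, w⁆ z := by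
        rw [← LinearMap.sub_apply, ← map_sub]
        congr 2
        rw [lie_lie x y w, ← lie_skew ⁅x, w⁆ y, ← lie_skew ⁅y, w⁆ x]
        abel
      have h3 : killingForm ℂ g ⁅⁅z, w⁆, x⁆ y = - killingForm ℂ g ⁅⁅x, y⁆, w⁆ z := by
        rw [hinv, hinv ⁅x, y⁆ w z, ← lie_skew w z, map_neg, neg_neg,
          LieModule.traceForm_comm]
      rw [map_neg, h1, h3]
      linear_combination -h2⟩

end Env

end

/-!
The dual `(Ug)^∨` consists of the functions on the formal group of `g`. The pullback of the
cocycle `f` to `Ug` is closed, and it is made exact by the Poincaré homotopy for the contraction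
`φ_t`, which is `exp(t log)` on group-like elements.

Every element of `Ug` is a linear combination of divided powers `yᵐ / m!` (`Env.ext_dpow`), and
`∑ₘ yᵐ / m!` is formally group-like. Evaluating there turns convolution identities into identities
of power series in one variable: `pr` becomes the series `X` and `φ_t` becomes `exp(t X)`
(`Env.hasSymbol_pr`, `Env.hasSymbol_phi`). Hence `φ_0 = ηε`, `φ_1 = id`, `dφ_t/dt = φ_t ⋆ pr`, and
`A_t` is the pullback under `φ_t` of the Maurer-Cartan form. It satisfies the Maurer-Cartan equation
and the differential equation `dA_t(·, x)/dt = pr(· x) + [A_t(·, x), pr]`, with `A_0 = 0` and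
`A_1(a, x) = ε(a) x`; the differential equation also shows that the values of `A_t` lie in `g`.
All families are polynomial in `t` when evaluated at a fixed element of `Ug`, so that no topology
on `Ug` is needed (`PolyDeriv`).

The identities are obtained in `Ug`, so that injectivity of `g → Ug` is needed to transfer them to
`g`. Over an arbitrary Lie algebra this is deduced from the same homotopy one degree lower: for a
linear form `l` on `g`, it makes the pullback of `(x, y) ↦ l([x, y])` exact in a second way, and the
difference of the two primitives is a one-cocycle with values in `(Ug)^∨`. The corresponding
representation of `g` on `(Ug)^∨ × ℂ` extends to `Ug`. An element `z` of the kernel of `g → Ug`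
therefore acts as zero on it, which gives `l(z) = 0` (`Env.inc_injective`).

With these equations, the coboundary of `f(pr, A_t(·, x), A_t(·, y))` is the derivative in `t` of
`f(A_t(·, x), A_t(·, y), A_t(·, z))` (`Env.tri_coboundary`). Integration over `[0, 1]` gives a
cochain `Env.lift` with values in `(Ug)^∨` whose coboundary is `ε f` (`Env.d₂₃_lift`). Its
restriction to `Ug⁺` is therefore a cocycle, namely `α`, and the Yoneda product represents `[f]`
because `Env.lift` is a lift of `α` to `(Ug)^∨` (`yonedaProduct_represents`).

Finally, two crossed modules `X`, `Y` with the same kernel and cokernel are equivalent if and only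
if they represent the same class (`CrossedExtension.equivalent_iff`). Morphisms preserve the
represented classes. Conversely, if both represent the class of one cocycle, then the amalgam of
`X.m` and `Y.m` along the common kernel, with the factor set given by the two lifts of the
curvature, defines an extension of `g`; it is the target of a crossed module with source
`X.m × Y.m`, which maps to both `X` and `Y`.
-/

noncomputable section

attribute [local instance 100] LieRing.ofAssociativeRing

/-! ### Extensions of Lie algebras by nonabelian kernels -/

section NonabelianExtension

variable {K : Type*} [CommRing K] {M g : Type*} [LieRing M] [LieAlgebra K M]
  [LieRing g] [LieAlgebra K g]

/-- The formal Chevalley-Eilenberg coboundary of `b : Λ² g → M` with respect to a linear map `D`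
from `g` to the derivations of `M`, which need not be an action. -/
def formalCoboundary (D : g →ₗ[K] LieDerivation K M M) (b : twoCochain K g M) (x y z : g) : M :=
  D x (b y z) - D y (b x z) + D z (b x y) - b ⁅x, y⁆ z + b ⁅x, z⁆ y - b ⁅y, z⁆ x

/-- A factor set for an extension of `g` by the (nonabelian) Lie algebra `M`: derivations `D x`
of `M` which commute up to the inner derivations given by `b`, where `b` is closed. -/
structure IsFactorSet (D : g →ₗ[K] LieDerivation K M M) (b : twoCochain K g M) : Prop where
  comm : ∀ x y m, D x (D y m) - D y (D x m) = D ⁅x, y⁆ m + ⁅b x y, m⁆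
  closed : ∀ x y z, formalCoboundary D b x y z = 0

/-- The extension of `g` by `M` given by a factor set; the underlying space is `M × g`. -/
@[ext] structure FactorSetExt {D : g →ₗ[K] LieDerivation K M M} {b : twoCochain K g M}
    (h : IsFactorSet D b) where
  fst : M
  snd : g

namespace FactorSetExt

variable {D : g →ₗ[K] LieDerivation K M M} {b : twoCochain K g M} (h : IsFactorSet D b)

/-- The underlying space of the extension given by a factor set. -/
def equivProd : FactorSetExt h ≃ M × g where
  toFun p := (p.fst, p.snd)
  invFun p := ⟨p.1, p.2⟩

instance : AddCommGroup (FactorSetExt h) := (equivProd h).addCommGroup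
instance : Module K (FactorSetExt h) := (equivProd h).module K

@[simp] theorem fst_add (p q : FactorSetExt h) : (p + q).1 = p.1 + q.1 := rfl
@[simp] theorem snd_add (p q : FactorSetExt h) : (p + q).2 = p.2 + q.2 := rfl
@[simp] theorem fst_zero : (0 : FactorSetExt h).1 = 0 := rfl
@[simp] theorem snd_zero : (0 : FactorSetExt h).2 = 0 := rfl
@[simp] theorem fst_smul (t : K) (p : FactorSetExt h) : (t • p).1 = t • p.1 := rfl
@[simp] theorem snd_smul (t : K) (p : FactorSetExt h) : (t • p).2 = t • p.2 := rfl

instance : Bracket (FactorSetExt h) (FactorSetExt h) where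
  bracket p q := ⟨⁅p.1, q.1⁆ + D p.2 q.1 - D q.2 p.1 + b p.2 q.2, ⁅p.2, q.2⁆⟩

@[simp] theorem fst_lie (p q : FactorSetExt h) :
    ⁅p, q⁆.1 = ⁅p.1, q.1⁆ + D p.2 q.1 - D q.2 p.1 + b p.2 q.2 := rfl
@[simp] theorem snd_lie (p q : FactorSetExt h) : ⁅p, q⁆.2 = ⁅p.2, q.2⁆ := rfl

instance : LieRing (FactorSetExt h) where
  add_lie p q r := by
    ext
    · simp; abel
    · simp
  lie_add p q r := by
    ext
    · simp; abel
    · simp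
  lie_self p := by ext <;> simp
  leibniz_lie p q r := by
    ext
    · have hc := h.closed p.2 q.2 r.2
      have h1 := h.comm p.2 q.2 r.1
      have h2 := h.comm p.2 r.2 q.1
      have h3 := h.comm q.2 r.2 p.1
      simp only [formalCoboundary] at hc
      simp only [fst_lie, snd_lie, lie_add, lie_sub, add_lie, sub_lie, map_add, map_sub,
        LieDerivation.apply_lie_eq_add, fst_add, lie_lie p.1 q.1 r.1]
      rw [sub_eq_iff_eq_add] at h1 h2 h3
      rw [h1, h2, h3, ← twoCochain_skew b ⁅p.2, r.2⁆ q.2, ← twoCochain_skew b ⁅q.2, r.2⁆ p.2,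
        ← lie_skew (b p.2 r.2) q.1, ← lie_skew (b q.2 r.2) p.1,
        ← lie_skew (D q.2 p.1) r.1, ← lie_skew (D r.2 p.1) q.1]
      rw [← sub_eq_zero] at hc ⊢
      rw [← hc]
      abel
    · simp

instance : LieAlgebra K (FactorSetExt h) where
  lie_smul t p q := by
    ext
    · simp [smul_add, smul_sub]
    · simp

end FactorSetExt

end NonabelianExtension

/-! ### The class of a crossed module -/

namespace CrossedExtension

variable {K : Type*} [Field K] {g : Type u} [LieRing g] [LieAlgebra K g]
  {V : Type*} [AddCommGroup V] [Module K V] [LieRingModule g V] [LieModule K g V]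

/-- The curvature of a linear section of the projection to `g`. -/
def curvature (X : CrossedExtension K g V) (ρ : g →ₗ[K] X.n) : twoCochain K g X.n :=
  ⟨LinearMap.mk₂ K (fun x y => ⁅ρ x, ρ y⁆ - ρ ⁅x, y⁆)
    (fun x x' y => by simp only [map_add, add_lie]; abel)
    (fun t x y => by simp only [map_smul, smul_lie, smul_sub])
    (fun x y y' => by simp only [map_add, lie_add]; abel)
    (fun t x y => by simp only [map_smul, lie_smul, smul_sub]), fun x => by simp⟩

theorem curvature_apply (X : CrossedExtension K g V) (ρ : g →ₗ[K] X.n) (x y : g) :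
    X.curvature ρ x y = ⁅ρ x, ρ y⁆ - ρ ⁅x, y⁆ := rfl

theorem exists_lift_cochain {P Q : Type*} [AddCommGroup P] [Module K P] [AddCommGroup Q]
    [Module K Q] (μ : P →ₗ[K] Q) (c : twoCochain K g Q) (hc : ∀ x y, c x y ∈ LinearMap.range μ) :
    ∃ b : twoCochain K g P, ∀ x y, μ (b x y) = c x y := by
  obtain ⟨s, hs⟩ := μ.rangeRestrict.exists_rightInverse_of_surjective
    (LinearMap.range_rangeRestrict _)
  obtain ⟨s', hs'⟩ := LinearMap.exists_extend s
  refine ⟨⟨c.1.compr₂ s', fun x => by simp⟩, fun x y => ?_⟩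
  have h1 : s' (c x y) = s ⟨c x y, hc x y⟩ := DFunLike.congr_fun hs' ⟨c x y, hc x y⟩
  change μ (s' (c x y)) = _
  rw [h1]
  exact congrArg Subtype.val (DFunLike.congr_fun hs ⟨c x y, hc x y⟩)

theorem exists_lift_linear {P Q : Type*} [AddCommGroup P] [Module K P] [AddCommGroup Q]
    [Module K Q] (μ : P →ₗ[K] Q) (c : g →ₗ[K] Q) (hc : ∀ x, c x ∈ LinearMap.range μ) :
    ∃ b : g →ₗ[K] P, ∀ x, μ (b x) = c x := by
  obtain ⟨s, hs⟩ := μ.rangeRestrict.exists_rightInverse_of_surjective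
    (LinearMap.range_rangeRestrict _)
  obtain ⟨s', hs'⟩ := LinearMap.exists_extend s
  refine ⟨s' ∘ₗ c, fun x => ?_⟩
  have h1 : s' (c x) = s ⟨c x, hc x⟩ := DFunLike.congr_fun hs' ⟨c x, hc x⟩
  change μ (s' (c x)) = _
  rw [h1]
  exact congrArg Subtype.val (DFunLike.congr_fun hs ⟨c x, hc x⟩)

variable (X : CrossedExtension K g V)

theorem exists_section : ∃ ρ : g →ₗ[K] X.n, ∀ x, X.proj (ρ x) = x := by
  obtain ⟨ρ, hρ⟩ := (X.proj : X.n →ₗ[K] g).exists_rightInverse_of_surjective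
    (LinearMap.range_eq_top.mpr X.proj_surjective)
  exact ⟨ρ, fun x => DFunLike.congr_fun hρ x⟩

theorem exists_lift_curvature {ρ : g →ₗ[K] X.n} (hρ : ∀ x, X.proj (ρ x) = x) :
    ∃ b : twoCochain K g X.m, ∀ x y, X.μ (b x y) = ⁅ρ x, ρ y⁆ - ρ ⁅x, y⁆ := by
  refine exists_lift_cochain (X.μ : X.m →ₗ[K] X.n) (X.curvature ρ) fun x y => ?_
  obtain ⟨m, hm⟩ := (X.exact_n (X.curvature ρ x y)).mp (by
    rw [curvature_apply, map_sub, LieHom.map_lie, hρ, hρ, hρ, sub_self])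
  exact ⟨m, hm⟩

/-- The derivations of `m` given by a linear section. -/
def actOf (ρ : g →ₗ[K] X.n) : g →ₗ[K] LieDerivation K X.m X.m :=
  (X.act : X.n →ₗ[K] LieDerivation K X.m X.m) ∘ₗ ρ

theorem actOf_apply (ρ : g →ₗ[K] X.n) (x : g) (m : X.m) : X.actOf ρ x m = X.act (ρ x) m := rfl

theorem act_lie (a b : X.n) (m : X.m) :
    X.act ⁅a, b⁆ m = X.act a (X.act b m) - X.act b (X.act a m) := by
  rw [LieHom.map_lie, LieDerivation.commutator_apply]

theorem act_comm {ρ : g →ₗ[K] X.n} {b : twoCochain K g X.m}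
    (hb : ∀ x y, X.μ (b x y) = ⁅ρ x, ρ y⁆ - ρ ⁅x, y⁆) (x y : g) (m : X.m) :
    X.act (ρ x) (X.act (ρ y) m) - X.act (ρ y) (X.act (ρ x) m) =
      X.act (ρ ⁅x, y⁆) m + ⁅b x y, m⁆ := by
  rw [← X.isCrossed.act_map, hb, map_sub, LieDerivation.sub_apply, act_lie]
  abel

/-- The Bianchi identity: `μ` kills the formal coboundary of a lift of the curvature. -/
theorem μ_formalCoboundary {ρ : g →ₗ[K] X.n} {b : twoCochain K g X.m}
    (hb : ∀ x y, X.μ (b x y) = ⁅ρ x, ρ y⁆ - ρ ⁅x, y⁆) (x y z : g) :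
    X.μ (formalCoboundary (X.actOf ρ) b x y z) = 0 := by
  simp only [formalCoboundary, actOf_apply, map_add, map_sub, X.isCrossed.map_act, hb, lie_sub]
  have h1 := lie_lie (ρ x) (ρ y) (ρ z)
  have h2 : ρ ⁅⁅x, y⁆, z⁆ = ρ ⁅x, ⁅y, z⁆⁆ - ρ ⁅y, ⁅x, z⁆⁆ := by rw [lie_lie, map_sub]
  rw [h2, ← lie_skew (ρ z) (ρ ⁅x, y⁆), ← lie_skew (ρ y) (ρ ⁅x, z⁆), ← lie_skew (ρ x) (ρ ⁅y, z⁆),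
    ← lie_skew ⁅x, z⁆ y, ← lie_skew ⁅y, z⁆ x, map_neg, map_neg, ← lie_skew (ρ z) ⁅ρ x, ρ y⁆, h1]
  abel

theorem formalCoboundary_mem {ρ : g →ₗ[K] X.n} {b : twoCochain K g X.m}
    (hb : ∀ x y, X.μ (b x y) = ⁅ρ x, ρ y⁆ - ρ ⁅x, y⁆) (x y z : g) :
    ∃ v, X.incl v = formalCoboundary (X.actOf ρ) b x y z :=
  (X.exact_m _).mp (X.μ_formalCoboundary hb x y z)

/-- The change of the lift of the curvature when the section is changed by `μ ∘ l`. -/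
def gauge (ρ : g →ₗ[K] X.n) (b : twoCochain K g X.m) (l : g →ₗ[K] X.m) : twoCochain K g X.m :=
  ⟨LinearMap.mk₂ K
    (fun x y => b x y + X.act (ρ x) (l y) - X.act (ρ y) (l x) - l ⁅x, y⁆ + ⁅l x, l y⁆)
    (fun x x' y => by simp only [map_add, add_lie, LinearMap.add_apply, LieDerivation.add_apply]; abel)
    (fun t x y => by
      simp only [map_smul, smul_lie, LinearMap.smul_apply, LieDerivation.smul_apply, smul_sub,
        smul_add])
    (fun x y y' => by simp only [map_add, lie_add, LieDerivation.add_apply]; abel)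
    (fun t x y => by
      simp only [map_smul, lie_smul, LieDerivation.smul_apply, smul_sub, smul_add]),
    fun x => by simp⟩

theorem gauge_apply (ρ : g →ₗ[K] X.n) (b : twoCochain K g X.m) (l : g →ₗ[K] X.m) (x y : g) :
    X.gauge ρ b l x y =
      b x y + X.act (ρ x) (l y) - X.act (ρ y) (l x) - l ⁅x, y⁆ + ⁅l x, l y⁆ := rfl

theorem μ_gauge {ρ : g →ₗ[K] X.n} {b : twoCochain K g X.m}
    (hb : ∀ x y, X.μ (b x y) = ⁅ρ x, ρ y⁆ - ρ ⁅x, y⁆) (l : g →ₗ[K] X.m) (x y : g) :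
    X.μ (X.gauge ρ b l x y) =
      ⁅ρ x + X.μ (l x), ρ y + X.μ (l y)⁆ - (ρ ⁅x, y⁆ + X.μ (l ⁅x, y⁆)) := by
  simp only [gauge_apply, map_add, map_sub, X.isCrossed.map_act, hb, LieHom.map_lie, lie_add,
    add_lie]
  rw [← lie_skew (ρ y) (X.μ (l x))]
  abel

/-- The formal coboundary does not change with the section if the lift of the curvature is changed
accordingly. -/
theorem formalCoboundary_gauge {ρ ρ' : g →ₗ[K] X.n} {b : twoCochain K g X.m}
    (hb : ∀ x y, X.μ (b x y) = ⁅ρ x, ρ y⁆ - ρ ⁅x, y⁆) (l : g →ₗ[K] X.m)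
    (hρ' : ∀ x, ρ' x = ρ x + X.μ (l x)) (x y z : g) :
    formalCoboundary (X.actOf ρ') (X.gauge ρ b l) x y z =
      formalCoboundary (X.actOf ρ) b x y z := by
  have h1 := X.act_comm hb x y (l z)
  have h2 := X.act_comm hb x z (l y)
  have h3 := X.act_comm hb y z (l x)
  rw [sub_eq_iff_eq_add] at h1 h2 h3
  have h4 : l ⁅⁅x, y⁆, z⁆ = l ⁅x, ⁅y, z⁆⁆ - l ⁅y, ⁅x, z⁆⁆ := by rw [lie_lie, map_sub]
  have h5 := lie_lie (l x) (l y) (l z)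
  have h6 : ⁅⁅l y, l x⁆, l z⁆ = ⁅l y, ⁅l x, l z⁆⁆ - ⁅l x, ⁅l y, l z⁆⁆ := lie_lie _ _ _
  have h7 : ⁅⁅l z, l x⁆, l y⁆ = ⁅l y, ⁅l x, l z⁆⁆ := by
    rw [← lie_skew, ← lie_skew (l z), lie_neg, neg_neg]
  simp only [formalCoboundary, actOf_apply, hρ', gauge_apply, map_add, map_sub,
    LieDerivation.add_apply, X.isCrossed.act_map, lie_add, add_lie,
    LieDerivation.apply_lie_eq_add]
  rw [h1, h2, h3, h4, ← lie_skew ⁅x, z⁆ y, ← lie_skew ⁅y, z⁆ x, map_neg, map_neg, h5, h6, h7,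
    ← lie_skew (l z) (l y), lie_neg, ← lie_skew (b x y) (l z), ← lie_skew (b x z) (l y),
    ← lie_skew (b y z) (l x), ← lie_skew (l ⁅x, y⁆) (l z), ← lie_skew (l ⁅x, z⁆) (l y),
    ← lie_skew (l ⁅y, z⁆) (l x), ← lie_skew (X.act (ρ x) (l y)) (l z),
    ← lie_skew (X.act (ρ y) (l x)) (l z), ← lie_skew (X.act (ρ z) (l x)) (l y)]
  abel

theorem formalCoboundary_add_incl {ρ : g →ₗ[K] X.n} (hρ : ∀ x, X.proj (ρ x) = x)
    {b b' : twoCochain K g X.m} {w : twoCochain K g V}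
    (hw : ∀ x y, X.incl (w x y) = b' x y - b x y) (x y z : g) :
    formalCoboundary (X.actOf ρ) b' x y z =
      formalCoboundary (X.actOf ρ) b x y z + X.incl (d₂₃ K g V w x y z) := by
  have hw' : ∀ x y, b' x y = b x y + X.incl (w x y) := fun x y => by rw [hw]; abel
  simp only [formalCoboundary, actOf_apply, hw', map_add, map_sub, d₂₃_apply, X.act_incl, hρ]
  abel

/-- The formal coboundary of the lift of the curvature of a section does not depend on the choices,
up to a coboundary. -/
theorem exists_formalCoboundary_eq {ρ ρ' : g →ₗ[K] X.n} {b b' : twoCochain K g X.m}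
    (hρ : ∀ x, X.proj (ρ x) = x) (hρ' : ∀ x, X.proj (ρ' x) = x)
    (hb : ∀ x y, X.μ (b x y) = ⁅ρ x, ρ y⁆ - ρ ⁅x, y⁆)
    (hb' : ∀ x y, X.μ (b' x y) = ⁅ρ' x, ρ' y⁆ - ρ' ⁅x, y⁆) :
    ∃ w : twoCochain K g V, ∀ x y z, formalCoboundary (X.actOf ρ') b' x y z =
      formalCoboundary (X.actOf ρ) b x y z + X.incl (d₂₃ K g V w x y z) := by
  obtain ⟨l, hl⟩ := exists_lift_linear (X.μ : X.m →ₗ[K] X.n) (ρ' - ρ) fun x => by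
    obtain ⟨m, hm⟩ := (X.exact_n ((ρ' - ρ) x)).mp (by
      rw [LinearMap.sub_apply, map_sub, hρ, hρ', sub_self])
    exact ⟨m, hm⟩
  have hl' : ∀ x, ρ' x = ρ x + X.μ (l x) := fun x => by
    have := hl x
    rw [LieHom.coe_toLinearMap] at this
    rw [this, LinearMap.sub_apply]; abel
  obtain ⟨w, hw⟩ := exists_lift_cochain X.incl (b' - X.gauge ρ b l) fun x y => by
    obtain ⟨v, hv⟩ := (X.exact_m (b' x y - X.gauge ρ b l x y)).mp (by
      rw [map_sub, X.μ_gauge hb, hb', hl', hl', hl', sub_self])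
    exact ⟨v, hv⟩
  refine ⟨w, fun x y z => ?_⟩
  rw [X.formalCoboundary_add_incl hρ' (b := X.gauge ρ b l) (b' := b') (w := w) fun x y => hw x y,
    X.formalCoboundary_gauge hb l hl']

theorem d₂₃_mem_threeCocycle (w : twoCochain K g V) : d₂₃ K g V w ∈ threeCocycle K g V := by
  refine ⟨⟨fun x y => ?_, fun x y => ?_⟩, fun x y z t => ?_⟩
  · have := twoCochain_skew w ⁅x, y⁆ x
    simp
  · have := twoCochain_skew w ⁅x, y⁆ y
    simp
  · have e : ∀ a b c : g, ⁅c, ⁅a, b⁆⁆ = ⁅b, ⁅a, c⁆⁆ - ⁅a, ⁅b, c⁆⁆ := fun a b c => by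
      rw [← lie_skew c, lie_lie, neg_sub]
    simp only [dThree, d₂₃_apply, lie_add, lie_sub, lie_lie x y, lie_lie x z, lie_lie x t,
      lie_lie y z, lie_lie y t, lie_lie z t, map_sub, LinearMap.sub_apply]
    rw [← twoCochain_skew w ⁅x, y⁆ ⁅z, t⁆, ← twoCochain_skew w ⁅x, z⁆ ⁅y, t⁆,
      ← twoCochain_skew w ⁅x, t⁆ ⁅y, z⁆, ← lie_skew z y, ← lie_skew t y, ← lie_skew t z,
      ← lie_skew y x, ← lie_skew z x, ← lie_skew t x]
    simp only [lie_neg, map_neg, LinearMap.neg_apply, e x y z, e x y t, e x z t, e y z t,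
      map_sub, LinearMap.sub_apply]
    abel

variable {X}

theorem mk_eq_mk_iff (γ γ' : threeCocycle K g V) :
    LieH3.mk K g V γ = LieH3.mk K g V γ' ↔ ∃ w, d₂₃ K g V w = γ.1 - γ'.1 := by
  rw [← sub_eq_zero, LieH3.mk, LieH3.mk, ← map_sub, Submodule.mkQ_apply,
    Submodule.Quotient.mk_eq_zero]
  exact Iff.rfl

theorem Represents.unique {c c' : LieH3 K g V} (h : X.Represents c) (h' : X.Represents c') :
    c = c' := by
  obtain ⟨γ, ⟨ρ, b, hρ, hb, hγ⟩, rfl⟩ := h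
  obtain ⟨γ', ⟨ρ', b', hρ', hb', hγ'⟩, rfl⟩ := h'
  obtain ⟨w, hw⟩ := X.exists_formalCoboundary_eq hρ' hρ hb' hb
  refine (mk_eq_mk_iff _ _).mpr ⟨w, ?_⟩
  ext x y z
  refine X.incl_injective ?_
  have h := hw x y z
  simp only [formalCoboundary, actOf_apply] at h
  rw [← hγ, ← hγ', ← sub_eq_iff_eq_add'] at h
  rw [← h, LinearMap.sub_apply, LinearMap.sub_apply, LinearMap.sub_apply, map_sub]

/-- Every cocycle in the class of a crossed module is associated to it. -/
theorem Represents.isAssociatedCocycle {γ : threeCocycle K g V}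
    (h : X.Represents (LieH3.mk K g V γ)) : X.IsAssociatedCocycle γ := by
  obtain ⟨γ', ⟨ρ, b, hρ, hb, hγ'⟩, hγ⟩ := h
  obtain ⟨w, hw⟩ := (mk_eq_mk_iff _ _).mp hγ.symm
  let b' : twoCochain K g X.m := b + ⟨w.1.compr₂ X.incl, fun x => by simp⟩
  have hb' : ∀ x y, b' x y = b x y + X.incl (w x y) := fun x y => rfl
  refine ⟨ρ, b', hρ, fun x y => ?_, fun x y z => ?_⟩
  · rw [hb', map_add, hb, (X.exact_m _).mpr ⟨_, rfl⟩, add_zero]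
  · have h1 := X.formalCoboundary_add_incl hρ (b := b) (b' := b') (w := w)
      (fun x y => by rw [hb']; abel) x y z
    refine Eq.trans ?_ h1.symm
    have h2 : formalCoboundary (X.actOf ρ) b x y z = X.incl (γ'.1 x y z) := (hγ' x y z).symm
    rw [h2, hw, ← map_add]
    simp

variable {Y : CrossedExtension K g V}

theorem Represents.map (F : Hom X Y) {c : LieH3 K g V} (h : X.Represents c) : Y.Represents c := by
  obtain ⟨γ, ⟨ρ, b, hρ, hb, hγ⟩, rfl⟩ := h
  refine ⟨γ, ⟨(F.ψ : X.n →ₗ[K] Y.n) ∘ₗ ρ, ⟨b.1.compr₂ F.φ, fun x => by simp⟩, fun x => ?_,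
    fun x y => ?_, fun x y z => ?_⟩, rfl⟩
  · exact (F.comm_proj _).trans (hρ x)
  · change Y.μ (F.φ (b x y)) = ⁅F.ψ (ρ x), F.ψ (ρ y)⁆ - F.ψ (ρ ⁅x, y⁆)
    rw [F.comm, hb, map_sub, LieHom.map_lie]
  · rw [← F.comm_incl, hγ]
    simp only [map_add, map_sub, F.equivariant]
    rfl

/-- Morphisms reflect the represented class: an associated cocycle of `X` is one of `Y`, so that it
lies in the only class which `Y` represents. -/
theorem Represents.comap (F : Hom X Y) {c : LieH3 K g V} (h : Y.Represents c) :
    X.Represents c := by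
  obtain ⟨γ, ⟨ρ, b, hρ, hb, hγ⟩, rfl⟩ := h
  obtain ⟨σ, hσ⟩ := X.exists_section
  obtain ⟨a, ha⟩ := X.exists_lift_curvature hσ
  let a' : twoCochain K g Y.m := ⟨a.1.compr₂ F.φ, fun x => by simp⟩
  have ha' : ∀ x y, a' x y = F.φ (a x y) := fun _ _ => rfl
  obtain ⟨w, hw⟩ := Y.exists_formalCoboundary_eq (ρ' := (F.ψ : X.n →ₗ[K] Y.n) ∘ₗ σ) (b' := a') hρ
    (fun x => (F.comm_proj _).trans (hσ x)) hb (fun x y => by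
      rw [ha', F.comm, ha, map_sub, LieHom.map_lie]; rfl)
  let γ' : threeCocycle K g V := γ + ⟨d₂₃ K g V w, d₂₃_mem_threeCocycle w⟩
  refine ⟨γ', ⟨σ, a, hσ, ha, fun x y z => ?_⟩, (mk_eq_mk_iff _ _).mpr ⟨w, by simp [γ']⟩⟩
  obtain ⟨v, hv⟩ := X.formalCoboundary_mem ha x y z
  refine Eq.trans (congrArg X.incl ?_) hv
  apply Y.incl_injective
  have h1 : Y.incl (γ.1 x y z) = formalCoboundary (Y.actOf ρ) b x y z := hγ x y z
  have h2 : F.φ (formalCoboundary (X.actOf σ) a x y z) =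
      formalCoboundary (Y.actOf ((F.ψ : X.n →ₗ[K] Y.n) ∘ₗ σ)) a' x y z := by
    simp only [formalCoboundary, actOf_apply, map_add, map_sub, F.equivariant]
    rfl
  rw [← F.comm_incl v, hv, h2, hw, ← h1, ← map_add]
  rfl

theorem Equivalent.represents_iff (h : X.Equivalent Y) (c : LieH3 K g V) :
    X.Represents c ↔ Y.Represents c := by
  induction h with
  | rel _ _ h => exact ⟨fun h' => h'.map h.some, fun h' => h'.comap h.some⟩
  | refl => exact Iff.rfl
  | symm _ _ _ ih => exact ih.symm
  | trans _ _ _ _ _ ih ih' => exact ih.trans ih'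

end CrossedExtension

/-! ### Crossed modules with the same class are equivalent -/

section Derivations

variable {K : Type*} [CommRing K] {A B : Type*} [LieRing A] [LieAlgebra K A]
  [LieRing B] [LieAlgebra K B]

/-- The derivation of a product of Lie algebras given by derivations of the factors. -/
def prodDerivation : LieDerivation K A A × LieDerivation K B B →ₗ⁅K⁆
    LieDerivation K (A × B) (A × B) where
  toFun d :=
    { toLinearMap := (d.1 : A →ₗ[K] A).prodMap (d.2 : B →ₗ[K] B)
      leibniz' := fun p q => by
        ext <;> simp }
  map_add' _ _ := rfl
  map_smul' _ _ := rfl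
  map_lie' {d e} := by
    ext p <;> simp

/-- The derivation of a quotient Lie algebra induced by a derivation which preserves the ideal. -/
def quotientDerivation (I : LieIdeal K A) (d : LieDerivation K A A) (hd : ∀ a ∈ I, d a ∈ I) :
    LieDerivation K (A ⧸ I) (A ⧸ I) where
  toLinearMap := Submodule.mapQ I.toSubmodule I.toSubmodule (d : A →ₗ[K] A) hd
  leibniz' p q := by
    obtain ⟨a, rfl⟩ := LieSubmodule.Quotient.surjective_mk' I p
    obtain ⟨b, rfl⟩ := LieSubmodule.Quotient.surjective_mk' I q
    have h : d ⁅a, b⁆ = ⁅a, d b⁆ - ⁅b, d a⁆ := d.apply_lie_eq_sub a b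
    exact congrArg (LieSubmodule.Quotient.mk' I) h

end Derivations

/-- The homomorphism `(m, x) ↦ p m + ρ x` from the extension given by a factor set. -/
def FactorSetExt.lift {K : Type*} [CommRing K] {M g N : Type*} [LieRing M] [LieAlgebra K M]
    [LieRing g] [LieAlgebra K g] [LieRing N] [LieAlgebra K N]
    {D : g →ₗ[K] LieDerivation K M M} {b : twoCochain K g M} (h : IsFactorSet D b)
    (p : M →ₗ⁅K⁆ N) (ρ : g →ₗ[K] N) (hp : ∀ x m, p (D x m) = ⁅ρ x, p m⁆)
    (hb : ∀ x y, p (b x y) = ⁅ρ x, ρ y⁆ - ρ ⁅x, y⁆) : FactorSetExt h →ₗ⁅K⁆ N where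
  toFun e := p e.1 + ρ e.2
  map_add' e e' := by simp only [FactorSetExt.fst_add, FactorSetExt.snd_add, map_add]; abel
  map_smul' t e := by
    simp only [FactorSetExt.fst_smul, FactorSetExt.snd_smul, map_smul, RingHom.id_apply, smul_add]
  map_lie' {e e'} := by
    simp only [FactorSetExt.fst_lie, FactorSetExt.snd_lie, map_add, map_sub, hp, hb,
      LieHom.map_lie, lie_add, add_lie]
    rw [← lie_skew (ρ e'.2) (p e.1)]
    abel

namespace CrossedExtension

variable {K : Type*} [Field K] {g : Type u} [LieRing g] [LieAlgebra K g]
  {V : Type*} [AddCommGroup V] [Module K V] [LieRingModule g V] [LieModule K g V]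
  (X Y : CrossedExtension K g V)

theorem lie_incl (a : X.m) (w : V) : ⁅a, X.incl w⁆ = 0 := by
  rw [← lie_skew, ← X.isCrossed.act_map, (X.exact_m _).mpr ⟨w, rfl⟩, map_zero,
    LieDerivation.zero_apply, neg_zero]

/-- The diagonal copy of the kernel `V`, a central ideal in the product. -/
def diagonalIdeal : LieIdeal K (X.m × Y.m) where
  toSubmodule := LinearMap.range (X.incl.prod Y.incl)
  lie_mem {a p} hp := by
    obtain ⟨w, rfl⟩ := hp
    rw [show ⁅a, (X.incl.prod Y.incl) w⁆ = 0 from Prod.ext (X.lie_incl _ w) (Y.lie_incl _ w)]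
    exact zero_mem (LinearMap.range (X.incl.prod Y.incl))

theorem mem_diagonalIdeal (p : X.m × Y.m) :
    p ∈ diagonalIdeal X Y ↔ ∃ w, (X.incl w, Y.incl w) = p := Iff.rfl

/-- The direct sum of `X.m` and `Y.m`, amalgamated along `V`. -/
abbrev Amalgam := (X.m × Y.m) ⧸ diagonalIdeal X Y

/-- The quotient map to the amalgamated sum. -/
def toAmalgam : X.m × Y.m →ₗ[K] Amalgam X Y := (diagonalIdeal X Y).toSubmodule.mkQ

theorem toAmalgam_lie (p q : X.m × Y.m) :
    toAmalgam X Y ⁅p, q⁆ = ⁅toAmalgam X Y p, toAmalgam X Y q⁆ := rfl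

theorem toAmalgam_surjective : Function.Surjective (toAmalgam X Y) :=
  Submodule.mkQ_surjective _

theorem toAmalgam_eq_zero (p : X.m × Y.m) :
    toAmalgam X Y p = 0 ↔ ∃ w, (X.incl w, Y.incl w) = p :=
  Submodule.Quotient.mk_eq_zero _

/-- The homomorphism `(a, b) ↦ μ a` on the amalgamated sum. -/
def amalgamFst : Amalgam X Y →ₗ⁅K⁆ X.n where
  toLinearMap := Submodule.liftQ _ ((X.μ : X.m →ₗ[K] X.n) ∘ₗ LinearMap.fst K X.m Y.m) (by
    rintro _ ⟨w, rfl⟩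
    exact (X.exact_m _).mpr ⟨w, rfl⟩)
  map_lie' {p q} := by
    obtain ⟨p, rfl⟩ := toAmalgam_surjective X Y p
    obtain ⟨q, rfl⟩ := toAmalgam_surjective X Y q
    exact X.μ.map_lie p.1 q.1

/-- The homomorphism `(a, b) ↦ μ b` on the amalgamated sum. -/
def amalgamSnd : Amalgam X Y →ₗ⁅K⁆ Y.n where
  toLinearMap := Submodule.liftQ _ ((Y.μ : Y.m →ₗ[K] Y.n) ∘ₗ LinearMap.snd K X.m Y.m) (by
    rintro _ ⟨w, rfl⟩
    exact (Y.exact_m _).mpr ⟨w, rfl⟩)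
  map_lie' {p q} := by
    obtain ⟨p, rfl⟩ := toAmalgam_surjective X Y p
    obtain ⟨q, rfl⟩ := toAmalgam_surjective X Y q
    exact Y.μ.map_lie p.2 q.2

variable {X Y} {ρ : g →ₗ[K] X.n} {σ : g →ₗ[K] Y.n}

theorem prodDerivation_mem (hρ : ∀ x, X.proj (ρ x) = x) (hσ : ∀ x, Y.proj (σ x) = x) (x : g)
    (p : X.m × Y.m) (hp : p ∈ diagonalIdeal X Y) :
    prodDerivation (X.actOf ρ x, Y.actOf σ x) p ∈ diagonalIdeal X Y := by
  obtain ⟨w, rfl⟩ := hp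
  refine (mem_diagonalIdeal X Y _).mpr ⟨⁅x, w⁆, ?_⟩
  refine Prod.ext ?_ ?_
  · change X.incl ⁅x, w⁆ = X.act (ρ x) (X.incl w)
    rw [X.act_incl, hρ]
  · change Y.incl ⁅x, w⁆ = Y.act (σ x) (Y.incl w)
    rw [Y.act_incl, hσ]

/-- The derivations of the amalgamated sum given by linear sections. -/
def amalgamAct (hρ : ∀ x, X.proj (ρ x) = x) (hσ : ∀ x, Y.proj (σ x) = x) :
    g →ₗ[K] LieDerivation K (Amalgam X Y) (Amalgam X Y) where
  toFun x := quotientDerivation (diagonalIdeal X Y) (prodDerivation (X.actOf ρ x, Y.actOf σ x))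
    (prodDerivation_mem hρ hσ x)
  map_add' x y := by
    ext p
    obtain ⟨p, rfl⟩ := toAmalgam_surjective X Y p
    refine congrArg (toAmalgam X Y) ?_
    change prodDerivation (X.actOf ρ (x + y), Y.actOf σ (x + y)) p =
      prodDerivation (X.actOf ρ x, Y.actOf σ x) p + prodDerivation (X.actOf ρ y, Y.actOf σ y) p
    rw [map_add, map_add]
    rfl
  map_smul' t x := by
    ext p
    obtain ⟨p, rfl⟩ := toAmalgam_surjective X Y p
    refine congrArg (toAmalgam X Y) ?_
    change prodDerivation (X.actOf ρ (t • x), Y.actOf σ (t • x)) p =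
      t • prodDerivation (X.actOf ρ x, Y.actOf σ x) p
    rw [map_smul, map_smul]
    rfl

theorem amalgamAct_apply (hρ : ∀ x, X.proj (ρ x) = x) (hσ : ∀ x, Y.proj (σ x) = x) (x : g)
    (p : X.m × Y.m) : amalgamAct hρ hσ x (toAmalgam X Y p) =
      toAmalgam X Y (X.act (ρ x) p.1, Y.act (σ x) p.2) := rfl

/-- The sum of lifts of the curvatures in the amalgamated sum. -/
def amalgamCochain (b : twoCochain K g X.m) (c : twoCochain K g Y.m) :
    twoCochain K g (Amalgam X Y) :=
  ⟨LinearMap.mk₂ K (fun x y => toAmalgam X Y (b x y, c x y))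
    (fun x x' y => by rw [← map_add]; simp)
    (fun t x y => by rw [← map_smul]; simp)
    (fun x y y' => by rw [← map_add]; simp)
    (fun t x y => by rw [← map_smul]; simp),
    fun x => by
      rw [LinearMap.mk₂_apply, twoCochain_alt, twoCochain_alt]
      exact map_zero _⟩

theorem amalgamCochain_apply (b : twoCochain K g X.m) (c : twoCochain K g Y.m) (x y : g) :
    amalgamCochain b c x y = toAmalgam X Y (b x y, c x y) := rfl

/-- For crossed modules with a common associated cocycle `γ`, the formal coboundaries of the two
lifts of the curvature form the diagonal element `γ` of `V × V`, which vanishes in the amalgamated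
sum. -/
theorem isFactorSet_amalgam (hρ : ∀ x, X.proj (ρ x) = x) (hσ : ∀ x, Y.proj (σ x) = x)
    {b : twoCochain K g X.m} {c : twoCochain K g Y.m}
    (hb : ∀ x y, X.μ (b x y) = ⁅ρ x, ρ y⁆ - ρ ⁅x, y⁆)
    (hc : ∀ x y, Y.μ (c x y) = ⁅σ x, σ y⁆ - σ ⁅x, y⁆) {γ : g →ₗ[K] g →ₗ[K] g →ₗ[K] V}
    (hbγ : ∀ x y z, X.incl (γ x y z) = formalCoboundary (X.actOf ρ) b x y z)
    (hcγ : ∀ x y z, Y.incl (γ x y z) = formalCoboundary (Y.actOf σ) c x y z) :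
    IsFactorSet (amalgamAct hρ hσ) (amalgamCochain b c) where
  comm x y p := by
    obtain ⟨p, rfl⟩ := toAmalgam_surjective X Y p
    simp only [amalgamAct_apply, amalgamCochain_apply, ← toAmalgam_lie, ← map_add, ← map_sub]
    refine congrArg (toAmalgam X Y) (Prod.ext ?_ ?_)
    · exact X.act_comm hb x y p.1
    · exact Y.act_comm hc x y p.2
  closed x y z := by
    simp only [formalCoboundary, amalgamAct_apply, amalgamCochain_apply, ← map_add, ← map_sub]
    exact (toAmalgam_eq_zero X Y _).mpr ⟨γ x y z, Prod.ext (hbγ x y z) (hcγ x y z)⟩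

/-- Crossed modules with a common associated cocycle receive morphisms from a third one, the
crossed module `X.m × Y.m → E` where `E` is an extension of `g` by the amalgamated sum. -/
theorem exists_span {γ : threeCocycle K g V} (hX : X.IsAssociatedCocycle γ)
    (hY : Y.IsAssociatedCocycle γ) :
    ∃ Z : CrossedExtension K g V, Nonempty (Hom Z X) ∧ Nonempty (Hom Z Y) := by
  obtain ⟨ρ, b, hρ, hb, hbγ⟩ := hX
  obtain ⟨σ, c, hσ, hc, hcγ⟩ := hY
  have h := isFactorSet_amalgam hρ hσ hb hc hbγ hcγ
  let F : FactorSetExt h →ₗ⁅K⁆ X.n := FactorSetExt.lift h (amalgamFst X Y) ρ (fun x p => by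
    obtain ⟨p, rfl⟩ := toAmalgam_surjective X Y p
    exact X.isCrossed.map_act (ρ x) p.1) hb
  let G : FactorSetExt h →ₗ⁅K⁆ Y.n := FactorSetExt.lift h (amalgamSnd X Y) σ (fun x p => by
    obtain ⟨p, rfl⟩ := toAmalgam_surjective X Y p
    exact Y.isCrossed.map_act (σ x) p.2) hc
  have hF : ∀ p x, F ⟨toAmalgam X Y p, x⟩ = X.μ p.1 + ρ x := fun _ _ => rfl
  have hG : ∀ p x, G ⟨toAmalgam X Y p, x⟩ = Y.μ p.2 + σ x := fun _ _ => rfl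
  have hFp : ∀ e : FactorSetExt h, X.proj (F e) = e.2 := by
    rintro ⟨p, x⟩
    obtain ⟨p, rfl⟩ := toAmalgam_surjective X Y p
    rw [hF, map_add, (X.exact_n _).mpr ⟨_, rfl⟩, hρ, zero_add]
  have hGp : ∀ e : FactorSetExt h, Y.proj (G e) = e.2 := by
    rintro ⟨p, x⟩
    obtain ⟨p, rfl⟩ := toAmalgam_surjective X Y p
    rw [hG, map_add, (Y.exact_n _).mpr ⟨_, rfl⟩, hσ, zero_add]
  let act : FactorSetExt h →ₗ⁅K⁆ LieDerivation K (X.m × Y.m) (X.m × Y.m) :=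
    prodDerivation.comp ((X.act.comp F).prod (Y.act.comp G))
  have hact : ∀ e p, act e p = (X.act (F e) p.1, Y.act (G e) p.2) := fun _ _ => rfl
  let μ : X.m × Y.m →ₗ⁅K⁆ FactorSetExt h :=
    { toFun := fun p => ⟨toAmalgam X Y p, 0⟩
      map_add' := fun p q => FactorSetExt.ext (map_add _ p q) (add_zero (0 : g)).symm
      map_smul' := fun t p => FactorSetExt.ext (map_smul _ t p) (smul_zero t).symm
      map_lie' := fun {p q} => FactorSetExt.ext
        (by simp [-LieAlgebra.Prod.bracket_apply, toAmalgam_lie]) (by simp) }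
  have hμ : ∀ p, μ p = ⟨toAmalgam X Y p, 0⟩ := fun _ => rfl
  let Z : CrossedExtension K g V :=
    { m := X.m × Y.m
      n := FactorSetExt h
      μ := μ
      act := act
      isCrossed :=
        { map_act := by
            rintro ⟨q, x⟩ p
            obtain ⟨q, rfl⟩ := toAmalgam_surjective X Y q
            rw [hμ, hμ, hact, hF, hG]
            refine FactorSetExt.ext ?_ (lie_zero x).symm
            simp only [FactorSetExt.fst_lie, map_add, map_zero, LieDerivation.zero_apply,
              amalgamAct_apply, LieDerivation.add_apply, sub_zero, add_zero, ← toAmalgam_lie,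
              X.isCrossed.act_map, Y.isCrossed.act_map]
            rw [← map_add]
            rfl
          act_map := fun p q => by
            rw [hact, hμ, hF, hG, map_zero, map_zero, add_zero, add_zero, X.isCrossed.act_map,
              Y.isCrossed.act_map]
            rfl }
      incl := X.incl.prod Y.incl
      proj :=
        { toFun := fun e => e.2
          map_add' := fun _ _ => rfl
          map_smul' := fun _ _ => rfl
          map_lie' := rfl }
      incl_injective := fun v w hvw => X.incl_injective (congrArg Prod.fst hvw)
      exact_m := fun p => by
        have h0 : μ p = 0 ↔ toAmalgam X Y p = 0 :=
          ⟨fun hp => congrArg FactorSetExt.fst hp, fun hp => FactorSetExt.ext hp rfl⟩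
        exact h0.trans (toAmalgam_eq_zero X Y p)
      exact_n := fun e => by
        constructor
        · intro he
          obtain ⟨p, hp⟩ := toAmalgam_surjective X Y e.1
          exact ⟨p, FactorSetExt.ext hp he.symm⟩
        · rintro ⟨p, rfl⟩
          rfl
      proj_surjective := fun x => ⟨⟨0, x⟩, rfl⟩
      act_incl := fun e w => by
        rw [hact]
        refine Prod.ext ?_ ?_
        · exact (X.act_incl _ _).trans (by rw [hFp]; rfl)
        · exact (Y.act_incl _ _).trans (by rw [hGp]; rfl) }
  refine ⟨Z, ⟨⟨LieHom.fst K X.m Y.m, F, fun p => ?_, fun e p => rfl, fun w => rfl, hFp⟩⟩,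
    ⟨⟨LieHom.snd K X.m Y.m, G, fun p => ?_, fun e p => rfl, fun w => rfl, hGp⟩⟩⟩
  · exact (add_zero _).symm.trans (congrArg _ (map_zero ρ).symm)
  · exact (add_zero _).symm.trans (congrArg _ (map_zero σ).symm)

/-- Crossed modules are classified by the cohomology classes which they represent. -/
theorem equivalent_iff {c d : LieH3 K g V} (hX : X.Represents c) (hY : Y.Represents d) :
    X.Equivalent Y ↔ c = d := by
  constructor
  · intro h
    exact ((h.represents_iff c).mp hX).unique hY
  · rintro rfl
    obtain ⟨γ, hγ, rfl⟩ := hX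
    obtain ⟨Z, hZX, hZY⟩ := exists_span hγ hY.isAssociatedCocycle
    exact (Relation.EqvGen.rel _ _ hZX).symm.trans _ _ _ (Relation.EqvGen.rel _ _ hZY)

end CrossedExtension

/-- The Yoneda product of `0 → V₁ → V₂ → V₃ → 0` with the abelian extension defined by `d ∘ a`
represents the class of `f` whenever `i ∘ f` is the coboundary of `a : Λ² g → V₂`. -/
theorem yonedaProduct_represents {K : Type*} [Field K] {g : Type u} [LieRing g] [LieAlgebra K g]
    {V₁ : Type*} [AddCommGroup V₁] [Module K V₁] [LieRingModule g V₁] [LieModule K g V₁]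
    {V₂ : Type u} [AddCommGroup V₂] [Module K V₂] [LieRingModule g V₂] [LieModule K g V₂]
    {V₃ : Type u} [AddCommGroup V₃] [Module K V₃] [LieRingModule g V₃] [LieModule K g V₃]
    (i : V₁ →ₗ⁅K, g⁆ V₂) (d : V₂ →ₗ⁅K, g⁆ V₃) (hi : Function.Injective i)
    (hex : Function.Exact i d) (hd : Function.Surjective d) (α : twoCocycle K g V₃)
    (a : twoCochain K g V₂) (ha : ∀ x y, d (a x y) = α.1 x y) (f : threeCocycle K g V₁)
    (hf : ∀ x y z, i (f.1 x y z) = d₂₃ K g V₂ a x y z) :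
    (yonedaProduct i d hi hex hd α).Represents (LieH3.mk K g V₁ f) := by
  let ρ : g →ₗ[K] LieAlgebra.ofTwoCocycle α :=
    { toFun := fun x => LieAlgebra.ofProd α (x, 0)
      map_add' := fun x y => by
        rw [← LieAlgebra.of_add]
        simp
      map_smul' := fun t x => by
        rw [RingHom.id_apply, ← LieAlgebra.of_smul]
        simp }
  refine ⟨f, ⟨ρ, a, fun x => rfl, fun x y => ?_, fun x y z => hf x y z⟩, rfl⟩
  have h : LieAlgebra.ofProd α (0, d (a x y)) =
      ⁅LieAlgebra.ofProd α (x, 0), LieAlgebra.ofProd α (y, 0)⁆ -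
        LieAlgebra.ofProd α (⁅x, y⁆, 0) := by
    rw [eq_sub_iff_add_eq, ← LieAlgebra.of_add, LieAlgebra.bracket_ofTwoCocycle, ha]
    simp
  exact h

/-! ### Polynomial curves in vector spaces -/

/-- `PolyDeriv c c'`: the curve `c : ℝ → V` is polynomial and `c'` is its derivative. The vector
space `V` carries no topology. -/
inductive PolyDeriv {V : Type*} [AddCommGroup V] [Module ℂ V] : (ℝ → V) → (ℝ → V) → Prop
  | monomial (n : ℕ) (v : V) :
      PolyDeriv (fun t => (t : ℂ) ^ n • v) (fun t => ((n : ℂ) * (t : ℂ) ^ (n - 1)) • v)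
  | add {c d c' d' : ℝ → V} : PolyDeriv c c' → PolyDeriv d d' →
      PolyDeriv (fun t => c t + d t) (fun t => c' t + d' t)

namespace PolyDeriv

variable {V W Z : Type*} [AddCommGroup V] [Module ℂ V] [AddCommGroup W] [Module ℂ W]
  [AddCommGroup Z] [Module ℂ Z] {c c' : ℝ → V} {d d' : ℝ → W}

theorem congr {a a' : ℝ → V} (h : PolyDeriv c c') (ha : ∀ t, a t = c t) (ha' : ∀ t, a' t = c' t) :
    PolyDeriv a a' := by
  rwa [funext ha, funext ha']

theorem const (v : V) : PolyDeriv (fun _ => v) (fun _ => 0) :=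
  (monomial 0 v).congr (by simp) (by simp)

theorem map (L : V →ₗ[ℂ] W) (h : PolyDeriv c c') :
    PolyDeriv (fun t => L (c t)) (fun t => L (c' t)) := by
  induction h with
  | monomial n v => exact (monomial n (L v)).congr (by simp) (by simp)
  | add _ _ h h' => exact (h.add h').congr (by simp) (by simp)

theorem bilin (B : V →ₗ[ℂ] W →ₗ[ℂ] Z) (h : PolyDeriv c c') (k : PolyDeriv d d') :
    PolyDeriv (fun t => B (c t) (d t)) (fun t => B (c' t) (d t) + B (c t) (d' t)) := by
  induction h with
  | monomial n v =>
    induction k with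
    | monomial m w =>
      refine (monomial (n + m) (B v w)).congr (fun t => ?_) (fun t => ?_)
      · simp [smul_smul, pow_add]
        ring_nf
      · simp only [map_smul, LinearMap.smul_apply, smul_smul, ← add_smul]
        congr 1
        rcases n with - | n <;> rcases m with - | m
        · simp
        · simp
        · simp
        · rw [show n + 1 + (m + 1) - 1 = n + 1 + m by omega, Nat.add_sub_cancel,
            Nat.add_sub_cancel]
          push_cast
          ring
    | add _ _ h h' => exact (h.add h').congr (by simp) (by intro t; simp; abel)
  | add _ _ h h' => exact (h.add h').congr (by simp) (by intro t; simp; abel)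

theorem smul (s : ℂ) (h : PolyDeriv c c') : PolyDeriv (fun t => s • c t) (fun t => s • c' t) :=
  h.map (s • LinearMap.id)

theorem neg (h : PolyDeriv c c') : PolyDeriv (fun t => -c t) (fun t => -c' t) :=
  h.map (-LinearMap.id)

theorem exists_deriv (h : PolyDeriv c c') : ∃ c'', PolyDeriv c' c'' := by
  induction h with
  | monomial n v =>
    exact ⟨_, ((monomial (n - 1) v).smul (n : ℂ)).congr (fun t => by rw [smul_smul])
      (fun t => rfl)⟩
  | add _ _ h h' =>
    obtain ⟨a, ha⟩ := h
    obtain ⟨b, hb⟩ := h'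
    exact ⟨_, ha.add hb⟩

theorem hasDerivAt {c c' : ℝ → ℂ} (h : PolyDeriv c c') (t : ℝ) : HasDerivAt c (c' t) t := by
  induction h with
  | monomial n v =>
    have h1 : HasDerivAt (fun s : ℝ => (s : ℂ)) 1 t := Complex.ofRealCLM.hasDerivAt
    simpa using (h1.pow n).mul_const v
  | add _ _ h h' => exact h.add h'

theorem continuous {c c' : ℝ → ℂ} (h : PolyDeriv c c') : Continuous c :=
  continuous_iff_continuousAt.mpr fun t => (h.hasDerivAt t).continuousAt

theorem continuous_deriv {c c' : ℝ → ℂ} (h : PolyDeriv c c') : Continuous c' :=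
  h.exists_deriv.choose_spec.continuous

theorem integral_eq_sub {c c' : ℝ → ℂ} (h : PolyDeriv c c') :
    ∫ t in (0 : ℝ)..1, c' t = c 1 - c 0 :=
  intervalIntegral.integral_eq_sub_of_hasDerivAt (fun t _ => h.hasDerivAt t)
    (h.continuous_deriv.intervalIntegrable _ _)

/-- Subspaces are cut out by linear forms, so that statements on curves reduce to `V = ℂ`. -/
theorem mem_of_forall_dual (P : Submodule ℂ V) {v : V}
    (h : ∀ f : Module.Dual ℂ V, (∀ w ∈ P, f w = 0) → f v = 0) : v ∈ P := by
  rw [← Submodule.Quotient.mk_eq_zero, ← Module.forall_dual_apply_eq_zero_iff ℂ]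
  exact fun f => h (f ∘ₗ P.mkQ) fun w hw => by
    rw [LinearMap.comp_apply, Submodule.mkQ_apply, (Submodule.Quotient.mk_eq_zero P).mpr hw,
      map_zero]

theorem deriv_mem (h : PolyDeriv c c') (P : Submodule ℂ V) (hP : ∀ t, c t ∈ P) (t : ℝ) :
    c' t ∈ P := by
  refine mem_of_forall_dual P fun f hf => ?_
  have h1 := (h.map f).hasDerivAt t
  rw [show (fun t => f (c t)) = fun _ => 0 from funext fun s => hf _ (hP s)] at h1
  exact h1.unique (hasDerivAt_const t 0)

/-- A polynomial curve stays in a subspace if it starts there and its derivative lies in it. -/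
theorem mem_of_deriv_mem (h : PolyDeriv c c') (P : Submodule ℂ V) (h0 : c 0 ∈ P)
    (hP : ∀ t, c' t ∈ P) (t : ℝ) : c t ∈ P := by
  refine mem_of_forall_dual P fun f hf => ?_
  have h1 := fun s => (h.map f).hasDerivAt s
  rw [is_const_of_deriv_eq_zero (fun s => (h1 s).differentiableAt)
    (fun s => (h1 s).deriv.trans (hf _ (hP s))) t 0]
  exact hf _ h0

end PolyDeriv

/-! ### Divided powers span the universal enveloping algebra -/

namespace Env

open Finset.HasAntidiagonal (antidiagonal)

variable {g : Type u} [LieRing g] [LieAlgebra ℂ g]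

variable (g) in
/-- The filtration of `Ug`: the span of the products of at most `n` elements of `g`. -/
def filtration (n : ℕ) : Submodule ℂ (U g) :=
  Submodule.span ℂ {a | ∃ l : List g, l.length ≤ n ∧ (l.map (inc g)).prod = a}

variable (g) in
/-- The span of the powers `yᵐ` for `y ∈ g` and `m ≤ n`. -/
def powerSpan (n : ℕ) : Submodule ℂ (U g) :=
  Submodule.span ℂ {a | ∃ (y : g) (m : ℕ), m ≤ n ∧ inc g y ^ m = a}

theorem powerSpan_mono {m n : ℕ} (h : m ≤ n) : powerSpan g m ≤ powerSpan g n :=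
  Submodule.span_mono fun _ ⟨y, k, hk, ha⟩ => ⟨y, k, hk.trans h, ha⟩

theorem pow_mem_filtration (y : g) (n : ℕ) : inc g y ^ n ∈ filtration g n :=
  Submodule.subset_span ⟨List.replicate n y, by simp, by simp⟩

theorem mul_inc_mem_filtration {n : ℕ} {a : U g} (ha : a ∈ filtration g n) (x : g) :
    a * inc g x ∈ filtration g (n + 1) := by
  induction ha using Submodule.span_induction with
  | mem a h =>
    obtain ⟨l, hl, rfl⟩ := h
    exact Submodule.subset_span ⟨l ++ [x], by simpa using hl, by simp⟩
  | zero => simp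
  | add a b _ _ ha hb => rw [add_mul]; exact add_mem ha hb
  | smul t a _ ha => rw [smul_mul_assoc]; exact Submodule.smul_mem _ _ ha

/-- The derivative at `0` of `(y + s x)ⁿ⁺¹` is `(n + 1) yⁿ x`, up to lower order terms. -/
theorem exists_polyDeriv_pow (x y : g) (n : ℕ) :
    ∃ c' : ℝ → U g, PolyDeriv (fun s : ℝ => inc g (y + (s : ℂ) • x) ^ (n + 1)) c' ∧
      c' 0 - ((n : ℂ) + 1) • (inc g y ^ n * inc g x) ∈ filtration g n := by
  have h1 : PolyDeriv (fun s : ℝ => inc g (y + (s : ℂ) • x)) (fun _ => inc g x) :=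
    ((PolyDeriv.const (inc g y)).add (PolyDeriv.monomial 1 (inc g x))).congr
      (fun t => by rw [map_add, map_smul, pow_one]) (by simp)
  induction n with
  | zero => exact ⟨_, h1.congr (by simp) (fun _ => rfl), by simp⟩
  | succ n ih =>
    obtain ⟨c', hc, hc'⟩ := ih
    refine ⟨_, (hc.bilin (LinearMap.mul ℂ (U g)) h1).congr (fun t => pow_succ _ _)
      (fun t => rfl), ?_⟩
    have h2 := mul_inc_mem_filtration hc' y
    -- moving `x` to the right past `y` costs `yⁿ [x, y]`, which has order `n + 1`
    have h3 : inc g y ^ n * inc g ⁅x, y⁆ ∈ filtration g (n + 1) :=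
      mul_inc_mem_filtration (pow_mem_filtration y n) _
    have h4 := add_mem h2 (Submodule.smul_mem _ ((n : ℂ) + 1) h3)
    convert h4 using 1
    simp only [LieHom.map_lie, LieRing.of_associative_ring_bracket, LinearMap.mul_apply', mul_sub,
      sub_mul, smul_sub, smul_mul_assoc, ← mul_assoc, ← pow_succ, Complex.ofReal_zero, zero_smul,
      add_zero]
    push_cast
    module

/-- Polarization: the symmetrization map is surjective. Modulo lower order terms, `yᵐ x` is a
multiple of the derivative at `0` of `(y + s x)ᵐ⁺¹`. -/
theorem filtration_le_powerSpan (n : ℕ) : filtration g n ≤ powerSpan g n := by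
  induction n using Nat.strong_induction_on with
  | _ n ih =>
    refine Submodule.span_le.mpr ?_
    rintro _ ⟨l, hl, rfl⟩
    rcases List.eq_nil_or_concat l with rfl | ⟨l, x, rfl⟩
    · exact Submodule.subset_span ⟨0, 0, Nat.zero_le _, by simp⟩
    · rw [List.concat_eq_append] at hl ⊢
      simp only [List.length_append, List.length_singleton] at hl
      simp only [List.map_append, List.map_cons, List.map_nil, List.prod_append, List.prod_singleton]
      have h1 : (l.map (inc g)).prod ∈ powerSpan g (n - 1) :=
        ih (n - 1) (by omega) (Submodule.subset_span ⟨l, by omega, rfl⟩)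
      generalize (l.map (inc g)).prod = b at h1
      induction h1 using Submodule.span_induction with
      | mem a h =>
        obtain ⟨y, m, hm, rfl⟩ := h
        obtain ⟨c', hc, hc'⟩ := exists_polyDeriv_pow x y m
        have h2 : c' 0 ∈ powerSpan g n := hc.deriv_mem (powerSpan g n) (fun t =>
          Submodule.subset_span ⟨_, m + 1, by omega, rfl⟩) 0
        have h3 := sub_mem h2 (powerSpan_mono (by omega) (ih m (by omega) hc'))
        rw [sub_sub_cancel] at h3
        exact (Submodule.smul_mem_iff _ (by exact_mod_cast Nat.succ_ne_zero m)).mp h3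
      | zero => simp
      | add a b _ _ ha hb => rw [add_mul]; exact add_mem ha hb
      | smul t a _ ha => rw [smul_mul_assoc]; exact Submodule.smul_mem _ _ ha

/-- The divided power `yᵐ / m!`. -/
def dpow (y : g) (m : ℕ) : U g := ((m.factorial : ℂ)⁻¹) • inc g y ^ m

theorem pow_eq_smul_dpow (y : g) (m : ℕ) : inc g y ^ m = (m.factorial : ℂ) • dpow y m := by
  rw [dpow, smul_smul, mul_inv_cancel₀ (by exact_mod_cast m.factorial_ne_zero), one_smul]

theorem span_dpow : Submodule.span ℂ {a : U g | ∃ y m, dpow y m = a} = ⊤ := by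
  rw [eq_top_iff, ← span_products, Submodule.span_le]
  rintro _ ⟨l, rfl⟩
  have h : (l.map (inc g)).prod ∈ powerSpan g l.length :=
    filtration_le_powerSpan _ (Submodule.subset_span ⟨l, le_rfl, rfl⟩)
  refine (Submodule.span_le.mpr ?_ : powerSpan g l.length ≤ _) h
  rintro _ ⟨y, m, -, rfl⟩
  rw [pow_eq_smul_dpow]
  exact Submodule.smul_mem _ _ (Submodule.subset_span ⟨y, m, rfl⟩)

@[elab_as_elim]
theorem dpow_induction {p : U g → Prop} (a : U g) (dpow : ∀ y m, p (dpow y m))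
    (zero : p 0) (add : ∀ a b, p a → p b → p (a + b)) (smul : ∀ (t : ℂ) a, p a → p (t • a)) :
    p a := by
  have ha : a ∈ Submodule.span ℂ {a : U g | ∃ y m, Env.dpow y m = a} := by
    rw [span_dpow]; trivial
  induction ha using Submodule.span_induction with
  | mem a h =>
    obtain ⟨y, m, rfl⟩ := h
    exact dpow y m
  | zero => exact zero
  | add a b _ _ ha hb => exact add a b ha hb
  | smul t a _ ha => exact smul t a ha

theorem ext_dpow {V : Type*} [AddCommGroup V] [Module ℂ V] {F G : U g →ₗ[ℂ] V}
    (h : ∀ y m, F (dpow y m) = G (dpow y m)) : F = G := by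
  refine LinearMap.ext_on span_dpow ?_
  rintro _ ⟨y, m, rfl⟩
  exact h y m

theorem counit_dpow (y : g) (m : ℕ) : counit g (dpow y m) = if m = 0 then 1 else 0 := by
  rw [dpow, map_smul, map_pow, counit_inc]
  split_ifs with h
  · simp [h]
  · simp [h]

/-- The divided powers of `y` are the coefficients of the grouplike series `exp (s y)`. -/
theorem comul_dpow (y : g) (m : ℕ) :
    comul g (dpow y m) = ∑ p ∈ antidiagonal m, dpow y p.1 ⊗ₜ[ℂ] dpow y p.2 := by
  have hc : Commute (inc g y ⊗ₜ[ℂ] (1 : U g)) ((1 : U g) ⊗ₜ[ℂ] inc g y) := by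
    rw [commute_iff_eq, Algebra.TensorProduct.tmul_mul_tmul, Algebra.TensorProduct.tmul_mul_tmul]
    simp
  rw [dpow, map_smul, map_pow, comul_inc, hc.add_pow', Finset.smul_sum]
  refine Finset.sum_congr rfl fun p hp => ?_
  rw [Algebra.TensorProduct.tmul_pow, Algebra.TensorProduct.tmul_pow, one_pow, one_pow,
    Algebra.TensorProduct.tmul_mul_tmul, one_mul, mul_one, dpow, dpow, TensorProduct.smul_tmul_smul,
    ← Nat.cast_smul_eq_nsmul ℂ, smul_smul]
  congr 1
  rw [Finset.HasAntidiagonal.mem_antidiagonal] at hp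
  subst hp
  have h1 := Nat.add_choose_mul_factorial_mul_factorial p.1 p.2
  rw [← Nat.choose_symm_add] at h1
  have e1 : (p.1.factorial : ℂ) ≠ 0 := by exact_mod_cast p.1.factorial_ne_zero
  have e2 : (p.2.factorial : ℂ) ≠ 0 := by exact_mod_cast p.2.factorial_ne_zero
  have e3 : ((p.1 + p.2).factorial : ℂ) ≠ 0 := by exact_mod_cast (p.1 + p.2).factorial_ne_zero
  field_simp
  exact_mod_cast h1

/-! ### Convolution of functions on the enveloping algebra -/

section Convolution

variable {V W Z : Type*} [AddCommGroup V] [Module ℂ V] [AddCommGroup W] [Module ℂ W]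
  [AddCommGroup Z] [Module ℂ Z]

/-- The convolution product `a ↦ ∑ B(F(a⁽¹⁾), G(a⁽²⁾))` with respect to a bilinear map `B`. -/
def cv (B : V →ₗ[ℂ] W →ₗ[ℂ] Z) (F : U g →ₗ[ℂ] V) (G : U g →ₗ[ℂ] W) : U g →ₗ[ℂ] Z :=
  TensorProduct.lift B ∘ₗ TensorProduct.map F G ∘ₗ (comul g).toLinearMap

theorem cv_dpow (B : V →ₗ[ℂ] W →ₗ[ℂ] Z) (F : U g →ₗ[ℂ] V) (G : U g →ₗ[ℂ] W) (y : g) (m : ℕ) :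
    cv B F G (dpow y m) = ∑ p ∈ antidiagonal m, B (F (dpow y p.1)) (G (dpow y p.2)) := by
  simp [cv, comul_dpow]

/-- Right translations act on functions by derivations of the convolution product. -/
theorem cv_comp_rightMul (B : V →ₗ[ℂ] W →ₗ[ℂ] Z) (F : U g →ₗ[ℂ] V) (G : U g →ₗ[ℂ] W) (x : g) :
    cv B F G ∘ₗ rightMul g x = cv B (F ∘ₗ rightMul g x) G + cv B F (G ∘ₗ rightMul g x) := by
  ext a
  simp only [cv, LinearMap.comp_apply, LinearMap.add_apply, AlgHom.toLinearMap_apply,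
    comul_rightMul, map_add]
  congr 2
  · rw [← LinearMap.comp_apply, ← TensorProduct.map_comp, LinearMap.comp_id]
  · rw [← LinearMap.comp_apply, ← TensorProduct.map_comp, LinearMap.comp_id]

theorem cv_add_left (B : V →ₗ[ℂ] W →ₗ[ℂ] Z) (F F' : U g →ₗ[ℂ] V) (G : U g →ₗ[ℂ] W) :
    cv B (F + F') G = cv B F G + cv B F' G := by
  rw [cv, TensorProduct.map_add_left, LinearMap.add_comp, LinearMap.comp_add]; rfl

theorem cv_add_right (B : V →ₗ[ℂ] W →ₗ[ℂ] Z) (F : U g →ₗ[ℂ] V) (G G' : U g →ₗ[ℂ] W) :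
    cv B F (G + G') = cv B F G + cv B F G' := by
  rw [cv, TensorProduct.map_add_right, LinearMap.add_comp, LinearMap.comp_add]; rfl

theorem cv_smul_left (B : V →ₗ[ℂ] W →ₗ[ℂ] Z) (t : ℂ) (F : U g →ₗ[ℂ] V) (G : U g →ₗ[ℂ] W) :
    cv B (t • F) G = t • cv B F G := by
  rw [cv, TensorProduct.map_smul_left, LinearMap.smul_comp, LinearMap.comp_smul]; rfl

theorem cv_smul_right (B : V →ₗ[ℂ] W →ₗ[ℂ] Z) (t : ℂ) (F : U g →ₗ[ℂ] V) (G : U g →ₗ[ℂ] W) :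
    cv B F (t • G) = t • cv B F G := by
  rw [cv, TensorProduct.map_smul_right, LinearMap.smul_comp, LinearMap.comp_smul]; rfl

theorem cv_neg_left (B : V →ₗ[ℂ] W →ₗ[ℂ] Z) (F : U g →ₗ[ℂ] V) (G : U g →ₗ[ℂ] W) :
    cv B (-F) G = -cv B F G := by
  rw [← neg_one_smul ℂ F, cv_smul_left, neg_one_smul]

theorem cv_neg_right (B : V →ₗ[ℂ] W →ₗ[ℂ] Z) (F : U g →ₗ[ℂ] V) (G : U g →ₗ[ℂ] W) :
    cv B F (-G) = -cv B F G := by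
  rw [← neg_one_smul ℂ G, cv_smul_right, neg_one_smul]

theorem polyDeriv_cv (B : V →ₗ[ℂ] W →ₗ[ℂ] Z) {F F' : ℝ → U g →ₗ[ℂ] V} {G G' : ℝ → U g →ₗ[ℂ] W}
    (hF : ∀ a, PolyDeriv (fun t => F t a) (fun t => F' t a))
    (hG : ∀ a, PolyDeriv (fun t => G t a) (fun t => G' t a)) (a : U g) :
    PolyDeriv (fun t => cv B (F t) (G t) a)
      (fun t => (cv B (F' t) (G t) + cv B (F t) (G' t)) a) := by
  simp only [cv, LinearMap.comp_apply, LinearMap.add_apply]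
  induction (comul g).toLinearMap a using TensorProduct.induction_on with
  | zero => simpa using PolyDeriv.const (0 : Z)
  | tmul b c => simpa using (hF b).bilin B (hG c)
  | add b c hb hc => exact (hb.add hc).congr (by simp) (by intro t; simp; abel)

theorem conv_eq_cv (p q : U g →ₗ[ℂ] U g) : conv p q = cv (LinearMap.mul ℂ (U g)) p q := rfl

theorem conv_dpow (p q : U g →ₗ[ℂ] U g) (y : g) (m : ℕ) :
    conv p q (dpow y m) = ∑ i ∈ antidiagonal m, p (dpow y i.1) * q (dpow y i.2) := by
  simp [conv_eq_cv, cv_dpow]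

theorem convOne_dpow (y : g) (m : ℕ) : convOne g (dpow y m) = if m = 0 then 1 else 0 := by
  simp only [convOne, LinearMap.comp_apply, AlgHom.toLinearMap_apply, counit_dpow]
  split_ifs <;> simp

/-- The generating series `∑ sᵐ F(yᵐ / m!)` of a function on `Ug` along `exp (s y)`. -/
def series (y : g) (F : U g →ₗ[ℂ] U g) : PowerSeries (U g) := PowerSeries.mk fun m => F (dpow y m)

theorem coeff_series (y : g) (F : U g →ₗ[ℂ] U g) (m : ℕ) :
    PowerSeries.coeff m (series y F) = F (dpow y m) := PowerSeries.coeff_mk _ _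

theorem ext_series {F G : U g →ₗ[ℂ] U g} (h : ∀ y, series y F = series y G) : F = G :=
  ext_dpow fun y m => by rw [← coeff_series, h, coeff_series]

theorem series_conv (y : g) (F G : U g →ₗ[ℂ] U g) :
    series y (conv F G) = series y F * series y G := by
  ext m
  rw [coeff_series, conv_dpow, PowerSeries.coeff_mul]
  simp only [coeff_series]

theorem series_convOne (y : g) : series y (convOne g) = 1 := by
  ext m
  rw [coeff_series, convOne_dpow, PowerSeries.coeff_one]

theorem conv_assoc (p q r : U g →ₗ[ℂ] U g) : conv (conv p q) r = conv p (conv q r) :=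
  ext_series fun y => by simp only [series_conv, mul_assoc]

theorem convOne_conv (p : U g →ₗ[ℂ] U g) : conv (convOne g) p = p :=
  ext_series fun y => by rw [series_conv, series_convOne, one_mul]

theorem conv_convOne (p : U g →ₗ[ℂ] U g) : conv p (convOne g) = p :=
  ext_series fun y => by rw [series_conv, series_convOne, mul_one]

end Convolution

/-! ### The logarithm of the identity and the contraction of the formal group -/

/-- `p` has symbol `P = ∑ cₘ Xᵐ` if it maps the grouplike series `exp y` to `P(y)`, that is
`yᵐ / m!` to `cₘ yᵐ` for all `y ∈ g`. -/
def HasSymbol (P : PowerSeries ℂ) (p : U g →ₗ[ℂ] U g) : Prop :=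
  ∀ y m, p (dpow y m) = PowerSeries.coeff m P • inc g y ^ m

namespace HasSymbol

variable {P Q : PowerSeries ℂ} {p q : U g →ₗ[ℂ] U g}

theorem unique (hp : HasSymbol P p) (hq : HasSymbol P q) : p = q :=
  ext_dpow fun y m => by rw [hp, hq]

theorem sub (hp : HasSymbol P p) (hq : HasSymbol Q q) : HasSymbol (P - Q) (p - q) := fun y m => by
  rw [LinearMap.sub_apply, hp, hq, map_sub, sub_smul]

theorem conv (hp : HasSymbol P p) (hq : HasSymbol Q q) : HasSymbol (P * Q) (conv p q) :=
  fun y m => by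
    rw [conv_dpow, PowerSeries.coeff_mul, Finset.sum_smul]
    refine Finset.sum_congr rfl fun i hi => ?_
    rw [hp, hq, smul_mul_smul_comm, ← pow_add, Finset.HasAntidiagonal.mem_antidiagonal.mp hi]

theorem convOne : HasSymbol 1 (convOne g) := fun y m => by
  rw [convOne_dpow, PowerSeries.coeff_one]
  split_ifs with h
  · simp [h]
  · simp

theorem convPow (hp : HasSymbol P p) (k : ℕ) : HasSymbol (P ^ k) (convPow p k) := by
  induction k with
  | zero => exact convOne
  | succ k ih =>
    rw [pow_succ']
    exact hp.conv ih

theorem id : HasSymbol (PowerSeries.exp ℂ) (LinearMap.id : U g →ₗ[ℂ] U g) := fun y m => by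
  simp [dpow, PowerSeries.coeff_exp]

theorem redId : HasSymbol (PowerSeries.exp ℂ - 1) (redId g) := id.sub convOne

end HasSymbol

/-- The identity `log (exp X) = X`, coefficientwise. -/
theorem sum_coeff_exp_sub_one_pow (m : ℕ) :
    ∑ k ∈ Finset.range m, ((-1 : ℂ) ^ k / (k + 1)) *
      PowerSeries.coeff m ((PowerSeries.exp ℂ - 1) ^ (k + 1)) =
        PowerSeries.coeff m (PowerSeries.X : PowerSeries ℂ) := by
  cases m with
  | zero => simp
  | succ n =>
    set u : PowerSeries ℂ := PowerSeries.exp ℂ - 1 with hu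
    have h0 : PowerSeries.constantCoeff u = 0 := by simp [hu]
    set L : PowerSeries ℂ := ∑ k ∈ Finset.range (n + 1), ((-1 : ℂ) ^ k / (k + 1)) • u ^ (k + 1)
    have hL : PowerSeries.derivative ℂ L = 1 - (-u) ^ (n + 1) := by
      have h1 : PowerSeries.derivative ℂ u = 1 - -u := by
        rw [hu, map_sub, PowerSeries.derivative_exp, PowerSeries.derivative_one]
        ring
      rw [← geom_sum_mul_neg, map_sum, Finset.sum_mul]
      refine Finset.sum_congr rfl fun k _ => ?_
      have hk : ((k : ℂ) + 1) ≠ 0 := by exact_mod_cast Nat.succ_ne_zero k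
      rw [Derivation.map_smul, PowerSeries.derivative_pow, h1, Nat.add_sub_cancel, neg_pow u k,
        ← nsmul_eq_mul, smul_mul_assoc, ← Nat.cast_smul_eq_nsmul ℂ, smul_smul]
      push_cast
      rw [div_mul_cancel₀ _ hk, PowerSeries.smul_eq_C_mul, map_pow, map_neg, map_one]
      ring
    have h2 := PowerSeries.coeff_derivative L n
    have h3 : PowerSeries.coeff n ((-u) ^ (n + 1)) = 0 := by
      refine PowerSeries.X_pow_dvd_iff.mp (pow_dvd_pow_of_dvd ?_ (n + 1)) n n.lt_succ_self
      rw [PowerSeries.X_dvd_iff, map_neg, h0, neg_zero]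
    have h4 : ((n : ℂ) + 1) ≠ 0 := by exact_mod_cast Nat.succ_ne_zero n
    rw [hL, map_sub, h3, sub_zero, PowerSeries.coeff_one] at h2
    have h5 : PowerSeries.coeff (n + 1) L = ∑ k ∈ Finset.range (n + 1), ((-1 : ℂ) ^ k / (k + 1)) *
        PowerSeries.coeff (n + 1) (u ^ (k + 1)) := by simp [L]
    rw [← h5, PowerSeries.coeff_X]
    refine mul_right_cancel₀ h4 (h2.symm.trans ?_)
    rcases n with - | n <;> simp

theorem hasSymbol_pr : HasSymbol PowerSeries.X (pr g) := fun y m => by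
  rw [← sum_coeff_exp_sub_one_pow, Finset.sum_smul]
  refine (finsum_eq_sum_of_support_subset _ fun k hk => ?_).trans
    (Finset.sum_congr rfl fun k _ => ?_)
  · rw [Finset.mem_coe, Finset.mem_range]
    by_contra hm
    refine hk ?_
    have h0 : PowerSeries.X ∣ PowerSeries.exp ℂ - 1 := by rw [PowerSeries.X_dvd_iff]; simp
    change (((-1 : ℂ) ^ k / (k + 1)) • convPow (redId g) (k + 1)) (dpow y m) = 0
    rw [LinearMap.smul_apply, (HasSymbol.redId.convPow (k + 1)) y m,
      PowerSeries.X_pow_dvd_iff.mp (pow_dvd_pow_of_dvd h0 (k + 1)) m (by omega), zero_smul, smul_zero]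
  · rw [LinearMap.smul_apply, (HasSymbol.redId.convPow (k + 1)) y m, smul_smul]

theorem hasSymbol_phi (t : ℂ) : HasSymbol (PowerSeries.rescale t (PowerSeries.exp ℂ)) (phi g t) :=
  fun y m => by
    have h : ∀ n, ((t ^ n / (n.factorial : ℂ)) • convPow (pr g) n) (dpow y m) =
        if n = m then (t ^ n / (n.factorial : ℂ)) • inc g y ^ m else 0 := fun n => by
      rw [LinearMap.smul_apply, (hasSymbol_pr.convPow n) y m, PowerSeries.coeff_X_pow]
      by_cases hn : n = m
      · simp [hn]
      · simp [hn, Ne.symm hn]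
    refine (finsum_eq_single _ m fun n hn => by rw [h, if_neg hn]).trans ?_
    rw [h, if_pos rfl, PowerSeries.coeff_rescale, PowerSeries.coeff_exp]
    simp [div_eq_mul_inv]

theorem phi_zero : phi g 0 = convOne g :=
  HasSymbol.unique (P := 1) (by simpa using hasSymbol_phi (g := g) 0) HasSymbol.convOne

theorem phi_one : phi g 1 = LinearMap.id :=
  HasSymbol.unique (by simpa using hasSymbol_phi (g := g) 1) HasSymbol.id

theorem conv_phi_phi (s t : ℂ) (h : s + t = 0) : conv (phi g s) (phi g t) = convOne g := by
  refine HasSymbol.unique (P := 1) ?_ HasSymbol.convOne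
  have := (hasSymbol_phi (g := g) s).conv (hasSymbol_phi t)
  rw [PowerSeries.exp_mul_exp_eq_exp_add, h] at this
  simpa using this

theorem conv_phi_pr (t : ℂ) : conv (phi g t) (pr g) = conv (pr g) (phi g t) :=
  ((hasSymbol_phi t).conv hasSymbol_pr).unique
    (by rw [mul_comm]; exact hasSymbol_pr.conv (hasSymbol_phi t))

theorem polyDeriv_of_dpow {V : Type*} [AddCommGroup V] [Module ℂ V] {F F' : ℝ → U g →ₗ[ℂ] V}
    (h : ∀ y m, PolyDeriv (fun t => F t (dpow y m)) (fun t => F' t (dpow y m))) (a : U g) :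
    PolyDeriv (fun t => F t a) (fun t => F' t a) := by
  induction a using dpow_induction with
  | dpow y m => exact h y m
  | zero => simpa using PolyDeriv.const (0 : V)
  | add a b ha hb => exact (ha.add hb).congr (by simp) (by simp)
  | smul t a ha => exact (ha.smul t).congr (by simp) (by simp)

theorem polyDeriv_phi_mul (s : ℂ) (a : U g) : PolyDeriv (fun t : ℝ => phi g (s * t) a)
    (fun t : ℝ => s • conv (phi g (s * t)) (pr g) a) := by
  refine polyDeriv_of_dpow (F := fun t : ℝ => phi g (s * t))
    (F' := fun t : ℝ => s • conv (phi g (s * t)) (pr g)) (fun y m => ?_) a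
  refine (PolyDeriv.monomial m ((s ^ m * (m.factorial : ℂ)⁻¹) • inc g y ^ m)).congr
    (fun t => ?_) (fun t => ?_)
  · rw [hasSymbol_phi, PowerSeries.coeff_rescale, PowerSeries.coeff_exp, smul_smul]
    congr 1
    simp
    ring
  · rw [LinearMap.smul_apply, ((hasSymbol_phi (s * t)).conv hasSymbol_pr) y m, smul_smul, smul_smul]
    congr 1
    rcases m with - | m
    · simp
    · have hm : ((m : ℂ) + 1) ≠ 0 := by exact_mod_cast Nat.succ_ne_zero m
      rw [PowerSeries.coeff_succ_mul_X, PowerSeries.coeff_rescale, PowerSeries.coeff_exp,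
        Nat.factorial_succ, Nat.add_sub_cancel]
      push_cast
      simp only [one_div]
      field_simp
      ring

theorem polyDeriv_phi (a : U g) :
    PolyDeriv (fun t : ℝ => phi g t a) (fun t : ℝ => conv (phi g t) (pr g) a) := by
  simpa using polyDeriv_phi_mul 1 a

theorem polyDeriv_phi_neg (a : U g) :
    PolyDeriv (fun t : ℝ => phi g (-t) a) (fun t : ℝ => (-conv (pr g) (phi g (-t))) a) := by
  simpa [conv_phi_pr] using polyDeriv_phi_mul (-1) a

/-! ### The Maurer-Cartan form of the contraction -/

theorem conv_comp_rightMul (p q : U g →ₗ[ℂ] U g) (x : g) :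
    conv p q ∘ₗ rightMul g x = conv (p ∘ₗ rightMul g x) q + conv p (q ∘ₗ rightMul g x) :=
  cv_comp_rightMul _ p q x

theorem conv_rightMul_comp (p q : U g →ₗ[ℂ] U g) (x : g) :
    conv p (rightMul g x ∘ₗ q) = rightMul g x ∘ₗ conv p q :=
  ext_dpow fun y m => by simp [conv_dpow, rightMul, mul_assoc, -UniversalEnvelopingAlgebra.ι_apply]

theorem convOne_comp_rightMul (x : g) : convOne g ∘ₗ rightMul g x = 0 := by
  ext a
  simp [convOne, rightMul, counit_inc, -UniversalEnvelopingAlgebra.ι_apply]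

theorem rightMul_lie_eq (x y : g) :
    rightMul g ⁅x, y⁆ = rightMul g y ∘ₗ rightMul g x - rightMul g x ∘ₗ rightMul g y :=
  LinearMap.ext fun a => rightMul_lie x y a

/-- The logarithmic derivative `φ_{-t} ⋆ (φ_t ∘ R_x)` of the contraction `φ_t`, with values
in `Ug`. -/
def logDeriv (t : ℂ) (x : g) : U g →ₗ[ℂ] U g := conv (phi g (-t)) (phi g t ∘ₗ rightMul g x)

theorem logDeriv_zero (x : g) : logDeriv 0 x = 0 := by
  rw [logDeriv, neg_zero, phi_zero, convOne_conv, convOne_comp_rightMul]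

theorem logDeriv_one (x : g) : logDeriv 1 x = rightMul g x ∘ₗ convOne g := by
  rw [logDeriv, phi_one, LinearMap.id_comp, ← LinearMap.comp_id (rightMul g x), conv_rightMul_comp,
    ← phi_one, conv_phi_phi _ _ (by simp), phi_one, LinearMap.comp_id]

/-- The differential equation `d/dt (φ_{-t} ⋆ (φ_t ∘ R_x)) = pr ∘ R_x + [φ_{-t} ⋆ (φ_t ∘ R_x), pr]`,
the component in the direction of `t` of the Maurer-Cartan equation. -/
theorem polyDeriv_logDeriv (x : g) (a : U g) :
    PolyDeriv (fun t : ℝ => logDeriv (t : ℂ) x a) (fun t : ℝ =>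
      (pr g ∘ₗ rightMul g x +
        (conv (logDeriv (t : ℂ) x) (pr g) - conv (pr g) (logDeriv (t : ℂ) x))) a) := by
  have h := polyDeriv_cv (LinearMap.mul ℂ (U g)) (polyDeriv_phi_neg (g := g))
    (G := fun t : ℝ => phi g t ∘ₗ rightMul g x)
    (G' := fun t : ℝ => conv (phi g t) (pr g) ∘ₗ rightMul g x)
    (fun a => polyDeriv_phi (rightMul g x a)) a
  refine h.congr (fun t => rfl) (fun t => ?_)
  congr 1
  rw [conv_comp_rightMul, cv_neg_left, cv_add_right]
  simp only [← conv_eq_cv]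
  rw [conv_assoc, ← conv_assoc _ (phi g t), conv_phi_phi _ _ (by simp), convOne_conv,
    ← conv_assoc _ _ (pr g), ← logDeriv]
  abel_nf

theorem phi_neg_comp_rightMul (t : ℂ) (x : g) :
    phi g (-t) ∘ₗ rightMul g x = -conv (logDeriv t x) (phi g (-t)) := by
  have h := conv_comp_rightMul (phi g (-t)) (phi g t) x
  rw [conv_phi_phi _ _ (by simp), convOne_comp_rightMul] at h
  rw [logDeriv, eq_neg_of_add_eq_zero_right h.symm]
  have h2 : conv (-conv (phi g (-t) ∘ₗ rightMul g x) (phi g t)) (phi g (-t)) =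
      -conv (conv (phi g (-t) ∘ₗ rightMul g x) (phi g t)) (phi g (-t)) := cv_neg_left _ _ _
  rw [h2, conv_assoc, conv_phi_phi _ _ (by simp), conv_convOne, neg_neg]

theorem logDeriv_comp_rightMul (t : ℂ) (x y : g) :
    logDeriv t y ∘ₗ rightMul g x = -conv (logDeriv t x) (logDeriv t y) +
      conv (phi g (-t)) (phi g t ∘ₗ rightMul g y ∘ₗ rightMul g x) := by
  rw [logDeriv, conv_comp_rightMul, phi_neg_comp_rightMul]
  have h2 : conv (-conv (logDeriv t x) (phi g (-t))) (phi g t ∘ₗ rightMul g y) =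
      -conv (conv (logDeriv t x) (phi g (-t))) (phi g t ∘ₗ rightMul g y) := cv_neg_left _ _ _
  rw [h2, conv_assoc, LinearMap.comp_assoc]

theorem logDeriv_maurerCartan (t : ℂ) (x y : g) :
    logDeriv t y ∘ₗ rightMul g x - logDeriv t x ∘ₗ rightMul g y +
      (conv (logDeriv t x) (logDeriv t y) - conv (logDeriv t y) (logDeriv t x)) =
        logDeriv t ⁅x, y⁆ := by
  have h : logDeriv t ⁅x, y⁆ = conv (phi g (-t)) (phi g t ∘ₗ rightMul g y ∘ₗ rightMul g x) -
      conv (phi g (-t)) (phi g t ∘ₗ rightMul g x ∘ₗ rightMul g y) := by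
    rw [logDeriv, rightMul_lie_eq, LinearMap.comp_sub, sub_eq_add_neg, sub_eq_add_neg]
    exact (cv_add_right _ _ _ _).trans (congrArg _ (cv_neg_right _ _ _))
  rw [h, logDeriv_comp_rightMul, logDeriv_comp_rightMul]
  abel

/-! ### Values in the Lie algebra -/

variable (g) in
/-- The image of `g` in `Ug`. -/
abbrev incRange : Submodule ℂ (U g) := LinearMap.range (inc g : g →ₗ[ℂ] U g)

theorem inc_mem_incRange (x : g) : inc g x ∈ incRange g := ⟨x, rfl⟩

theorem inc_toLie_of_mem {a : U g} (ha : a ∈ incRange g) : inc g (toLie g a) = a := by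
  obtain ⟨x, rfl⟩ := ha
  exact inc_toLie g x

theorem pr_dpow (y : g) (m : ℕ) : pr g (dpow y m) = if m = 1 then inc g y else 0 := by
  rw [hasSymbol_pr, PowerSeries.coeff_X]
  split_ifs with h
  · simp [h]
  · simp

theorem pr_mem (a : U g) : pr g a ∈ incRange g := by
  induction a using dpow_induction with
  | dpow y m =>
    rw [pr_dpow]
    split_ifs
    · exact inc_mem_incRange y
    · exact zero_mem _
  | zero => simp
  | add a b ha hb => rw [map_add]; exact add_mem ha hb
  | smul t a ha => rw [map_smul]; exact Submodule.smul_mem _ _ ha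

theorem conv_pr_dpow_succ (p : U g →ₗ[ℂ] U g) (y : g) (m : ℕ) :
    conv p (pr g) (dpow y (m + 1)) = p (dpow y m) * inc g y := by
  rw [conv_dpow, Finset.sum_eq_single (m, 1)]
  · rw [pr_dpow, if_pos rfl]
  · rintro ⟨i, j⟩ hij hne
    have h := Finset.HasAntidiagonal.mem_antidiagonal.mp hij
    rw [pr_dpow, if_neg, mul_zero]
    rintro rfl
    exact hne (Prod.ext (Nat.succ_injective h) rfl)
  · intro h
    exact absurd (Finset.HasAntidiagonal.mem_antidiagonal.mpr rfl : (m, 1) ∈ antidiagonal (m + 1)) h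

theorem pr_conv_dpow_succ (p : U g →ₗ[ℂ] U g) (y : g) (m : ℕ) :
    conv (pr g) p (dpow y (m + 1)) = inc g y * p (dpow y m) := by
  rw [conv_dpow, Finset.sum_eq_single (1, m)]
  · rw [pr_dpow, if_pos rfl]
  · rintro ⟨i, j⟩ hij hne
    have h := Finset.HasAntidiagonal.mem_antidiagonal.mp hij
    rw [pr_dpow, if_neg, zero_mul]
    rintro rfl
    exact hne (Prod.ext rfl (by simp at h ⊢; omega))
  · intro h
    exact absurd (Finset.HasAntidiagonal.mem_antidiagonal.mpr (add_comm 1 m) :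
      (1, m) ∈ antidiagonal (m + 1)) h

/-- The differential equation in `t` determines `logDeriv` recursively on the divided powers
of `y`, by brackets with `y`. -/
theorem logDeriv_mem (t : ℝ) (x : g) (a : U g) : logDeriv (t : ℂ) x a ∈ incRange g := by
  induction a using dpow_induction with
  | dpow y m =>
    induction m generalizing t with
    | zero =>
      refine (polyDeriv_logDeriv x (dpow y 0)).mem_of_deriv_mem (incRange g) ?_ (fun s => ?_) t
      · rw [Complex.ofReal_zero, logDeriv_zero]
        exact zero_mem _
      · refine add_mem (pr_mem _) ?_
        have h1 : pr g (dpow y 0) = 0 := pr_dpow y 0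
        have h2 : conv (logDeriv (s : ℂ) x) (pr g) (dpow y 0) = 0 := by
          simp [conv_dpow, h1]
        have h3 : conv (pr g) (logDeriv (s : ℂ) x) (dpow y 0) = 0 := by
          simp [conv_dpow, h1]
        rw [LinearMap.sub_apply, h2, h3, sub_zero]
        exact zero_mem _
    | succ m ih =>
      refine (polyDeriv_logDeriv x (dpow y (m + 1))).mem_of_deriv_mem (incRange g) ?_ (fun s => ?_) t
      · rw [Complex.ofReal_zero, logDeriv_zero]
        exact zero_mem _
      · refine add_mem (pr_mem _) ?_
        obtain ⟨z, hz⟩ := ih s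
        rw [LinearMap.sub_apply, conv_pr_dpow_succ, pr_conv_dpow_succ, ← hz]
        exact ⟨⁅z, y⁆, LieHom.map_lie _ _ _⟩
  | zero => simp
  | add a b ha hb => rw [map_add]; exact add_mem ha hb
  | smul t a ha => rw [map_smul]; exact Submodule.smul_mem _ _ ha

variable (g) in
/-- The Eulerian idempotent with values in `g`. -/
def prLie : U g →ₗ[ℂ] g := toLie g ∘ₗ pr g

theorem inc_comp_prLie : (inc g : g →ₗ[ℂ] U g) ∘ₗ prLie g = pr g :=
  LinearMap.ext fun a => inc_toLie_of_mem (pr_mem a)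

theorem A_eq (t : ℂ) (x : g) : A t x = toLie g ∘ₗ logDeriv t x := rfl

theorem inc_comp_A (t : ℝ) (x : g) : (inc g : g →ₗ[ℂ] U g) ∘ₗ A (t : ℂ) x = logDeriv (t : ℂ) x :=
  LinearMap.ext fun a => inc_toLie_of_mem (logDeriv_mem t x a)

variable (g) in
/-- The Lie bracket as a bilinear map. -/
def lieBilin : g →ₗ[ℂ] g →ₗ[ℂ] g := (LieModule.toEnd ℂ g g : g →ₗ[ℂ] Module.End ℂ g)

@[simp] theorem lieBilin_apply (x y : g) : lieBilin g x y = ⁅x, y⁆ := rfl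

/-- The Lie bracket of `g`-valued functions. -/
def cvLie (F G : U g →ₗ[ℂ] g) : U g →ₗ[ℂ] g := cv (lieBilin g) F G

theorem cvLie_dpow (F G : U g →ₗ[ℂ] g) (y : g) (m : ℕ) :
    cvLie F G (dpow y m) = ∑ i ∈ antidiagonal m, ⁅F (dpow y i.1), G (dpow y i.2)⁆ :=
  cv_dpow _ F G y m

theorem cvLie_skew (F G : U g →ₗ[ℂ] g) : cvLie F G = -cvLie G F :=
  ext_dpow fun y m => by
    rw [LinearMap.neg_apply, cvLie_dpow, cvLie_dpow, ← Finset.sum_neg_distrib,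
      ← Finset.Nat.sum_antidiagonal_swap]
    refine Finset.sum_congr rfl fun i _ => ?_
    rw [lie_skew]
    rfl

theorem inc_comp_cvLie (F G : U g →ₗ[ℂ] g) :
    (inc g : g →ₗ[ℂ] U g) ∘ₗ cvLie F G =
      conv ((inc g : g →ₗ[ℂ] U g) ∘ₗ F) ((inc g : g →ₗ[ℂ] U g) ∘ₗ G) -
        conv ((inc g : g →ₗ[ℂ] U g) ∘ₗ G) ((inc g : g →ₗ[ℂ] U g) ∘ₗ F) :=
  ext_dpow fun y m => by
    rw [LinearMap.sub_apply, conv_dpow, conv_dpow,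
      ← Finset.Nat.sum_antidiagonal_swap (n := m)
        (f := fun i => ((inc g : g →ₗ[ℂ] U g) ∘ₗ G) (dpow y i.1) * _),
      ← Finset.sum_sub_distrib, LinearMap.comp_apply, cvLie_dpow, map_sum]
    exact Finset.sum_congr rfl fun i _ => LieHom.map_lie _ _ _

/-- The derivative of `A` in `t` satisfies the differential equation up to the kernel of
`g → Ug`. -/
theorem exists_polyDeriv_A (x : g) : ∃ A' : ℝ → U g →ₗ[ℂ] g,
    (∀ a, PolyDeriv (fun t : ℝ => A (t : ℂ) x a) (fun t => A' t a)) ∧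
    ∀ t : ℝ, (inc g : g →ₗ[ℂ] U g) ∘ₗ A' t =
      (inc g : g →ₗ[ℂ] U g) ∘ₗ (prLie g ∘ₗ rightMul g x + cvLie (A (t : ℂ) x) (prLie g)) := by
  have h : ∀ t : ℝ, pr g ∘ₗ rightMul g x +
      (conv (logDeriv (t : ℂ) x) (pr g) - conv (pr g) (logDeriv (t : ℂ) x)) =
      (inc g : g →ₗ[ℂ] U g) ∘ₗ (prLie g ∘ₗ rightMul g x + cvLie (A (t : ℂ) x) (prLie g)) := fun t => by
    rw [LinearMap.comp_add, inc_comp_cvLie, inc_comp_A, inc_comp_prLie, ← LinearMap.comp_assoc,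
      inc_comp_prLie]
  refine ⟨fun t => toLie g ∘ₗ (pr g ∘ₗ rightMul g x +
      (conv (logDeriv (t : ℂ) x) (pr g) - conv (pr g) (logDeriv (t : ℂ) x))),
    fun a => (polyDeriv_logDeriv x a).map (toLie g), fun t => ?_⟩
  refine Eq.trans ?_ (h t)
  exact LinearMap.ext fun a => inc_toLie_of_mem (h t ▸ ⟨_, rfl⟩)

theorem inc_comp_A_maurerCartan (t : ℝ) (x y : g) :
    (inc g : g →ₗ[ℂ] U g) ∘ₗ (A (t : ℂ) y ∘ₗ rightMul g x - A (t : ℂ) x ∘ₗ rightMul g y +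
      cvLie (A (t : ℂ) x) (A (t : ℂ) y)) = (inc g : g →ₗ[ℂ] U g) ∘ₗ A (t : ℂ) ⁅x, y⁆ := by
  rw [LinearMap.comp_add, LinearMap.comp_sub, inc_comp_cvLie, ← LinearMap.comp_assoc,
    ← LinearMap.comp_assoc]
  simp only [inc_comp_A, logDeriv_maurerCartan]

theorem A_zero (x : g) : A 0 x = 0 := by rw [A_eq, logDeriv_zero, LinearMap.comp_zero]

theorem A_one_apply (x : g) (a : U g) : A 1 x a = counit g a • toLie g (inc g x) := by
  rw [A_eq, logDeriv_one, ← map_smul]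
  simp [convOne, rightMul, Algebra.algebraMap_eq_smul_one]

/-! ### Sums over threefold and fourfold antidiagonals -/

section Sums

open Finset.Nat (antidiagonalTuple)

variable {M : Type*} [AddCommMonoid M]

theorem sum_triple_left (m : ℕ) (h : ℕ → ℕ → ℕ → M) :
    ∑ p ∈ antidiagonal m, ∑ q ∈ antidiagonal p.1, h q.1 q.2 p.2 =
      ∑ ν ∈ antidiagonalTuple 3 m, h (ν 0) (ν 1) (ν 2) := by
  rw [Finset.sum_sigma']
  refine Finset.sum_nbij' (fun s => ![s.2.1, s.2.2, s.1.2])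
    (fun ν => ⟨(ν 0 + ν 1, ν 2), (ν 0, ν 1)⟩) ?_ ?_ ?_ ?_ ?_
  · rintro ⟨⟨i, j⟩, ⟨k, l⟩⟩ hs
    simp [Finset.Nat.mem_antidiagonalTuple, Fin.sum_univ_three] at hs ⊢
    omega
  · intro ν hν
    simp [Finset.Nat.mem_antidiagonalTuple, Fin.sum_univ_three] at hν ⊢
    omega
  · rintro ⟨⟨i, j⟩, ⟨k, l⟩⟩ hs
    simp at hs ⊢
    omega
  · intro ν _
    ext i
    fin_cases i <;> rfl
  · rintro ⟨⟨i, j⟩, ⟨k, l⟩⟩ _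
    rfl

theorem sum_triple_right (m : ℕ) (h : ℕ → ℕ → ℕ → M) :
    ∑ p ∈ antidiagonal m, ∑ q ∈ antidiagonal p.2, h p.1 q.1 q.2 =
      ∑ ν ∈ antidiagonalTuple 3 m, h (ν 0) (ν 1) (ν 2) := by
  rw [Finset.sum_sigma']
  refine Finset.sum_nbij' (fun s => ![s.1.1, s.2.1, s.2.2])
    (fun ν => ⟨(ν 0, ν 1 + ν 2), (ν 1, ν 2)⟩) ?_ ?_ ?_ ?_ ?_
  · rintro ⟨⟨i, j⟩, ⟨k, l⟩⟩ hs
    simp [Finset.Nat.mem_antidiagonalTuple, Fin.sum_univ_three] at hs ⊢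
    omega
  · intro ν hν
    simp [Finset.Nat.mem_antidiagonalTuple, Fin.sum_univ_three] at hν ⊢
    omega
  · rintro ⟨⟨i, j⟩, ⟨k, l⟩⟩ hs
    simp at hs ⊢
    omega
  · intro ν _
    ext i
    fin_cases i <;> rfl
  · rintro ⟨⟨i, j⟩, ⟨k, l⟩⟩ _
    rfl

theorem sum_quadruple_left (m : ℕ) (h : ℕ → ℕ → ℕ → ℕ → M) :
    ∑ p ∈ antidiagonal m, ∑ q ∈ antidiagonal p.2, ∑ r ∈ antidiagonal p.1, h r.1 r.2 q.1 q.2 =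
      ∑ ν ∈ antidiagonalTuple 4 m, h (ν 0) (ν 1) (ν 2) (ν 3) := by
  simp only [← Finset.sum_product']
  rw [Finset.sum_sigma']
  refine Finset.sum_nbij' (fun s => ![s.2.2.1, s.2.2.2, s.2.1.1, s.2.1.2])
    (fun ν => ⟨(ν 0 + ν 1, ν 2 + ν 3), ((ν 2, ν 3), (ν 0, ν 1))⟩) ?_ ?_ ?_ ?_ ?_
  · rintro ⟨⟨i, j⟩, ⟨⟨k, l⟩, ⟨k', l'⟩⟩⟩ hs
    simp [Finset.Nat.mem_antidiagonalTuple, Fin.sum_univ_four] at hs ⊢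
    omega
  · intro ν hν
    simp [Finset.Nat.mem_antidiagonalTuple, Fin.sum_univ_four] at hν ⊢
    omega
  · rintro ⟨⟨i, j⟩, ⟨⟨k, l⟩, ⟨k', l'⟩⟩⟩ hs
    simp at hs ⊢
    omega
  · intro ν _
    ext i
    fin_cases i <;> rfl
  · rintro ⟨⟨i, j⟩, ⟨⟨k, l⟩, ⟨k', l'⟩⟩⟩ _
    rfl

theorem sum_antidiagonalTuple_perm {n : ℕ} (m : ℕ) (σ : Equiv.Perm (Fin n)) (h : (Fin n → ℕ) → M) :
    ∑ ν ∈ antidiagonalTuple n m, h (ν ∘ σ) = ∑ ν ∈ antidiagonalTuple n m, h ν := by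
  refine Finset.sum_nbij' (· ∘ σ) (· ∘ σ.symm) ?_ ?_ ?_ ?_ ?_
  · intro ν hν
    rw [Finset.Nat.mem_antidiagonalTuple] at hν ⊢
    rw [← hν]
    exact Equiv.sum_comp σ ν
  · intro ν hν
    rw [Finset.Nat.mem_antidiagonalTuple] at hν ⊢
    rw [← hν]
    exact Equiv.sum_comp σ.symm ν
  · intro ν _
    ext i
    simp
  · intro ν _
    ext i
    simp
  · intro ν _
    rfl

end Sums

/-! ### The Lie algebra of functions with values in the Lie algebra -/

theorem cvLie_cvLie_left_dpow (F G H : U g →ₗ[ℂ] g) (y : g) (m : ℕ) :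
    cvLie (cvLie F G) H (dpow y m) = ∑ ν ∈ Finset.Nat.antidiagonalTuple 3 m,
      ⁅⁅F (dpow y (ν 0)), G (dpow y (ν 1))⁆, H (dpow y (ν 2))⁆ := by
  rw [← sum_triple_left m fun i j k => ⁅⁅F (dpow y i), G (dpow y j)⁆, H (dpow y k)⁆, cvLie_dpow]
  simp only [cvLie_dpow, sum_lie]

theorem cvLie_cvLie_right_dpow (F G H : U g →ₗ[ℂ] g) (y : g) (m : ℕ) :
    cvLie F (cvLie G H) (dpow y m) = ∑ ν ∈ Finset.Nat.antidiagonalTuple 3 m,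
      ⁅F (dpow y (ν 0)), ⁅G (dpow y (ν 1)), H (dpow y (ν 2))⁆⁆ := by
  rw [← sum_triple_right m fun i j k => ⁅F (dpow y i), ⁅G (dpow y j), H (dpow y k)⁆⁆, cvLie_dpow]
  simp only [cvLie_dpow, lie_sum]

theorem cvLie_jacobi (F G H : U g →ₗ[ℂ] g) :
    cvLie (cvLie F G) H = cvLie (cvLie F H) G + cvLie F (cvLie G H) :=
  ext_dpow fun y m => by
    have h := sum_antidiagonalTuple_perm m (Equiv.swap 1 2) fun ν : Fin 3 → ℕ =>
      ⁅⁅F (dpow y (ν 0)), H (dpow y (ν 1))⁆, G (dpow y (ν 2))⁆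
    rw [LinearMap.add_apply, cvLie_cvLie_left_dpow, cvLie_cvLie_left_dpow, cvLie_cvLie_right_dpow,
      ← h, ← Finset.sum_add_distrib]
    refine Finset.sum_congr rfl fun ν _ => ?_
    change _ = ⁅⁅F (dpow y (ν 0)), H (dpow y (ν 2))⁆, G (dpow y (ν 1))⁆ + _
    rw [lie_lie, ← lie_skew ⁅F (dpow y (ν 0)), H (dpow y (ν 2))⁆]
    abel

theorem cvLie_comp_rightMul (F G : U g →ₗ[ℂ] g) (x : g) :
    cvLie F G ∘ₗ rightMul g x = cvLie (F ∘ₗ rightMul g x) G + cvLie F (G ∘ₗ rightMul g x) :=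
  cv_comp_rightMul _ F G x

theorem cvLie_add_left (F F' G : U g →ₗ[ℂ] g) : cvLie (F + F') G = cvLie F G + cvLie F' G :=
  cv_add_left _ F F' G

theorem cvLie_add_right (F G G' : U g →ₗ[ℂ] g) : cvLie F (G + G') = cvLie F G + cvLie F G' :=
  cv_add_right _ F G G'

theorem cvLie_sub_left (F F' G : U g →ₗ[ℂ] g) : cvLie (F - F') G = cvLie F G - cvLie F' G := by
  rw [eq_sub_iff_add_eq, ← cvLie_add_left, sub_add_cancel]

variable (g) in
/-- The function `a ↦ ε(a) u`. -/
def constFn {V : Type*} [AddCommGroup V] [Module ℂ V] (u : V) : U g →ₗ[ℂ] V :=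
  (counit g).toLinearMap.smulRight u

theorem constFn_apply {V : Type*} [AddCommGroup V] [Module ℂ V] (u : V) (a : U g) :
    constFn g u a = counit g a • u := rfl

theorem cv_constFn {V W Z : Type*} [AddCommGroup V] [Module ℂ V] [AddCommGroup W] [Module ℂ W]
    [AddCommGroup Z] [Module ℂ Z] (B : V →ₗ[ℂ] W →ₗ[ℂ] Z) (u : V) (v : W) :
    cv B (constFn g u) (constFn g v) = constFn g (B u v) :=
  ext_dpow fun y m => by
    rw [cv_dpow, constFn_apply, counit_dpow]
    simp only [constFn_apply, counit_dpow]
    cases m with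
    | zero => simp
    | succ m =>
      refine (Finset.sum_eq_zero fun p hp => ?_).trans (by simp)
      have := Finset.HasAntidiagonal.mem_antidiagonal.mp hp
      rcases Nat.eq_zero_or_pos p.1 with h | h
      · rw [if_neg (show ¬p.2 = 0 by omega)]; simp
      · rw [if_neg (show ¬p.1 = 0 by omega)]; simp

theorem A_one (x : g) : A 1 x = constFn g (toLie g (inc g x)) := LinearMap.ext (A_one_apply x)

theorem A_add (t : ℂ) (x y : g) : A t (x + y) = A t x + A t y := by
  have h : rightMul g (x + y) = rightMul g x + rightMul g y := LinearMap.ext (rightMul_add x y)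
  rw [A, h, LinearMap.comp_add, conv_eq_cv, cv_add_right, LinearMap.comp_add]
  rfl

theorem A_smul (t s : ℂ) (x : g) : A t (s • x) = s • A t x := by
  have h : rightMul g (s • x) = s • rightMul g x := LinearMap.ext (rightMul_smul s x)
  rw [A, h, LinearMap.comp_smul, conv_eq_cv, cv_smul_right, LinearMap.comp_smul]
  rfl

variable (g) in
/-- The integral over `[0, 1]` of a continuous family of linear forms on `Ug`. -/
def integralDual (F : ℝ → Module.Dual ℂ (U g)) (hF : ∀ a, Continuous fun t => F t a) :
    Module.Dual ℂ (U g) where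
  toFun a := ∫ t in (0 : ℝ)..1, F t a
  map_add' a b := by
    simp only [map_add]
    exact intervalIntegral.integral_add ((hF a).intervalIntegrable _ _)
      ((hF b).intervalIntegrable _ _)
  map_smul' s a := by
    simp only [map_smul, smul_eq_mul, RingHom.id_apply]
    exact intervalIntegral.integral_const_mul s _

/-! ### The map from a Lie algebra to its enveloping algebra is injective -/

/-- Elements of the kernel of `g → Ug` act trivially on all `g`-modules. -/
theorem lie_eq_zero_of_inc {M : Type*} [AddCommGroup M] [Module ℂ M] [LieRingModule g M]
    [LieModule ℂ g M] {z : g} (hz : inc g z = 0) (m : M) : ⁅z, m⁆ = 0 := by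
  have h := UniversalEnvelopingAlgebra.lift_ι_apply ℂ (LieModule.toEnd ℂ g M) z
  rw [hz, map_zero] at h
  exact (congrArg (fun f : Module.End ℂ M => f m) h).symm

theorem lie_congr_of_inc {x x' : g} (h : inc g x = inc g x') (y : g) : ⁅x, y⁆ = ⁅x', y⁆ := by
  rw [← sub_eq_zero, ← sub_lie]
  exact lie_eq_zero_of_inc (by rw [map_sub, h, sub_self]) y

theorem cvLie_congr_left {F F' : U g →ₗ[ℂ] g}
    (h : (inc g : g →ₗ[ℂ] U g) ∘ₗ F = (inc g : g →ₗ[ℂ] U g) ∘ₗ F') (G : U g →ₗ[ℂ] g) :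
    cvLie F G = cvLie F' G :=
  ext_dpow fun y m => by
    rw [cvLie_dpow, cvLie_dpow]
    exact Finset.sum_congr rfl fun i _ => lie_congr_of_inc (DFunLike.congr_fun h _) _

theorem cvLie_congr_right {F F' : U g →ₗ[ℂ] g}
    (h : (inc g : g →ₗ[ℂ] U g) ∘ₗ F = (inc g : g →ₗ[ℂ] U g) ∘ₗ F') (G : U g →ₗ[ℂ] g) :
    cvLie G F = cvLie G F' := by
  rw [cvLie_skew, cvLie_congr_left h, ← cvLie_skew]

/-- The derivative `pr ∘ R_x + [A_t(·, x), pr]` of `A_t(·, x)` with respect to `t`. -/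
def velocity (t : ℂ) (x : g) : U g →ₗ[ℂ] g := prLie g ∘ₗ rightMul g x + cvLie (A t x) (prLie g)

theorem velocity_add (t : ℂ) (x y : g) : velocity t (x + y) = velocity t x + velocity t y := by
  have h : rightMul g (x + y) = rightMul g x + rightMul g y := LinearMap.ext (rightMul_add x y)
  rw [velocity, h, A_add, LinearMap.comp_add, cvLie_add_left, velocity, velocity]
  abel

theorem velocity_smul (t s : ℂ) (x : g) : velocity t (s • x) = s • velocity t x := by
  have h : rightMul g (s • x) = s • rightMul g x := LinearMap.ext (rightMul_smul s x)
  rw [velocity, h, A_smul, LinearMap.comp_smul, cvLie, cv_smul_left, ← smul_add]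
  rfl

theorem continuous_velocity (l : g →ₗ[ℂ] ℂ) (x : g) (a : U g) :
    Continuous fun t : ℝ => l (velocity (t : ℂ) x a) := by
  obtain ⟨A', hA, -⟩ := exists_polyDeriv_A x
  have h1 := polyDeriv_cv (lieBilin g) hA (fun a => PolyDeriv.const (prLie g a)) (G' := 0) a
  exact (((PolyDeriv.const (prLie g (rightMul g x a))).add h1).map l).continuous

/-- The coboundary of `velocity` is the derivative of `-[A_t(·, x), A_t(·, y)]` with respect
to `t`. -/
theorem velocity_curvature (t : ℝ) (x y : g) :
    velocity (t : ℂ) y ∘ₗ rightMul g x - velocity (t : ℂ) x ∘ₗ rightMul g y -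
      velocity (t : ℂ) ⁅x, y⁆ =
    -(cvLie (velocity (t : ℂ) x) (A (t : ℂ) y) + cvLie (A (t : ℂ) x) (velocity (t : ℂ) y)) := by
  have h1 := cvLie_congr_left (inc_comp_A_maurerCartan t x y) (prLie g)
  rw [cvLie_add_left, cvLie_sub_left] at h1
  simp only [velocity, LinearMap.add_comp, cvLie_comp_rightMul, cvLie_add_left, cvLie_add_right,
    rightMul_lie_eq, LinearMap.comp_sub, LinearMap.comp_assoc, ← h1,
    cvLie_jacobi (A (t : ℂ) x) (A (t : ℂ) y) (prLie g),
    cvLie_skew (A (t : ℂ) y) (prLie g ∘ₗ rightMul g x)]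
  abel

/-- The one-cochain `x ↦ ∫₀¹ l ∘ velocity t x dt` with values in the dual of `Ug`. -/
def velocityCochain (l : g →ₗ[ℂ] ℂ) : g →ₗ[ℂ] UDual g where
  toFun x := integralDual g (fun t : ℝ => l ∘ₗ velocity (t : ℂ) x) (continuous_velocity l x)
  map_add' x y := by
    ext a
    change ∫ t in (0 : ℝ)..1, l (velocity (t : ℂ) (x + y) a) =
      (∫ t in (0 : ℝ)..1, l (velocity (t : ℂ) x a)) + ∫ t in (0 : ℝ)..1, l (velocity (t : ℂ) y a)
    rw [← intervalIntegral.integral_add ((continuous_velocity l x a).intervalIntegrable _ _)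
      ((continuous_velocity l y a).intervalIntegrable _ _)]
    simp only [velocity_add, LinearMap.add_apply, map_add]
  map_smul' s x := by
    ext a
    change ∫ t in (0 : ℝ)..1, l (velocity (t : ℂ) (s • x) a) =
      s * ∫ t in (0 : ℝ)..1, l (velocity (t : ℂ) x a)
    rw [← intervalIntegral.integral_const_mul]
    simp only [velocity_smul, LinearMap.smul_apply, map_smul, smul_eq_mul]

theorem velocityCochain_apply (l : g →ₗ[ℂ] ℂ) (x : g) (a : U g) :
    velocityCochain l x a = ∫ t in (0 : ℝ)..1, l (velocity (t : ℂ) x a) := rfl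

/-- The coboundary of `velocityCochain l` is `-ε l([x, y])`. -/
theorem velocityCochain_coboundary (l : g →ₗ[ℂ] ℂ) (x y : g) (a : U g) :
    velocityCochain l y (a * inc g x) - velocityCochain l x (a * inc g y) -
      velocityCochain l ⁅x, y⁆ a = -(counit g a * l ⁅x, y⁆) := by
  obtain ⟨A', hA, hA'⟩ := exists_polyDeriv_A x
  obtain ⟨B', hB, hB'⟩ := exists_polyDeriv_A y
  have h1 := ((polyDeriv_cv (lieBilin g) hA hB a).map l).neg
  have h2 := h1.integral_eq_sub
  have h3 : ∀ t : ℝ, -l ((cv (lieBilin g) (A' t) (A (t : ℂ) y) +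
      cv (lieBilin g) (A (t : ℂ) x) (B' t)) a) =
      l (velocity (t : ℂ) y (a * inc g x)) - l (velocity (t : ℂ) x (a * inc g y)) -
        l (velocity (t : ℂ) ⁅x, y⁆ a) := fun t => by
    have h4 : cv (lieBilin g) (A' t) (A (t : ℂ) y) = cvLie (velocity (t : ℂ) x) (A (t : ℂ) y) :=
      cvLie_congr_left (hA' t) _
    have h5 : cv (lieBilin g) (A (t : ℂ) x) (B' t) = cvLie (A (t : ℂ) x) (velocity (t : ℂ) y) :=
      cvLie_congr_right (hB' t) _
    rw [h4, h5, ← map_neg, ← LinearMap.neg_apply, ← velocity_curvature, ← map_sub, ← map_sub]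
    rfl
  simp only [h3] at h2
  have hc : Continuous fun t : ℝ => l (velocity (t : ℂ) y (a * inc g x)) -
      l (velocity (t : ℂ) x (a * inc g y)) :=
    (continuous_velocity l y _).sub (continuous_velocity l x _)
  rw [velocityCochain_apply, velocityCochain_apply, velocityCochain_apply,
    ← intervalIntegral.integral_sub ((continuous_velocity l y _).intervalIntegrable _ _)
      ((continuous_velocity l x _).intervalIntegrable _ _),
    ← intervalIntegral.integral_sub (hc.intervalIntegrable _ _)
      ((continuous_velocity l _ a).intervalIntegrable _ _), h2]
  have h6 : ⁅toLie g (inc g x), toLie g (inc g y)⁆ = ⁅x, y⁆ := by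
    rw [lie_congr_of_inc (inc_toLie g x), ← lie_skew, lie_congr_of_inc (inc_toLie g y), lie_skew]
  rw [Complex.ofReal_one, Complex.ofReal_zero, A_one, A_one, cv_constFn, constFn_apply,
    lieBilin_apply, h6, A_zero, cv, TensorProduct.map_zero_left]
  simp

/-- The one-cocycle `velocityCochain l - ε l`. -/
def velocityCocycle (l : g →ₗ[ℂ] ℂ) : g →ₗ[ℂ] UDual g :=
  velocityCochain l -
    { toFun := fun x => l x • (counit g).toLinearMap
      map_add' := fun x y => by rw [map_add, add_smul]; rfl
      map_smul' := fun t x => by rw [map_smul, smul_assoc]; rfl }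

theorem velocityCocycle_apply (l : g →ₗ[ℂ] ℂ) (x : g) (a : U g) :
    velocityCocycle l x a = velocityCochain l x a - l x * counit g a := rfl

theorem velocityCocycle_lie (l : g →ₗ[ℂ] ℂ) (x y : g) :
    velocityCocycle l ⁅x, y⁆ = ⁅x, velocityCocycle l y⁆ - ⁅y, velocityCocycle l x⁆ := by
  ext a
  change _ = ⁅x, velocityCocycle l y⁆ a - ⁅y, velocityCocycle l x⁆ a
  have h := velocityCochain_coboundary l x y a
  simp only [UDual.lie_apply, velocityCocycle_apply, map_mul, counit_inc, mul_zero, sub_zero]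
  linear_combination -h

/-- The action of `g` on `(Ug)^∨ × ℂ` twisted by a one-cocycle. -/
def velocityRep (l : g →ₗ[ℂ] ℂ) : g →ₗ⁅ℂ⁆ Module.End ℂ (UDual g × ℂ) where
  toFun x := LinearMap.inl ℂ (UDual g) ℂ ∘ₗ
    ((LieModule.toEnd ℂ g (UDual g) x).coprod (LinearMap.toSpanSingleton ℂ _ (velocityCocycle l x)))
  map_add' x y := by
    ext p <;> simp
  map_smul' t x := by
    ext p <;> simp
  map_lie' {x y} := by
    refine LinearMap.ext fun p => Prod.ext ?_ ?_
    · simp [LieRing.of_associative_ring_bracket, velocityCocycle_lie, smul_sub]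
      abel
    · simp [LieRing.of_associative_ring_bracket]

/-- A weak form of the Poincaré-Birkhoff-Witt theorem. An element `z` of the kernel of `g → Ug`
acts as zero on every representation of `g`, but for any linear form `l` on `g` it maps `(0, 1)` to
`(-l(z) ε, 0)` in `velocityRep l`. -/
theorem inc_injective : Function.Injective (inc g) := by
  rw [injective_iff_map_eq_zero]
  intro z hz
  rw [← Module.forall_dual_apply_eq_zero_iff ℂ]
  intro l
  have h := UniversalEnvelopingAlgebra.lift_ι_apply ℂ (velocityRep l) z
  rw [hz, map_zero] at h
  have h1 : ⁅z, (0 : UDual g)⁆ + (1 : ℂ) • velocityCocycle l z = 0 :=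
    (congrArg (fun f : Module.End ℂ (UDual g × ℂ) => (f (0, 1)).1) h).symm
  rw [lie_zero, zero_add, one_smul] at h1
  have h2 : velocityCocycle l z 1 = 0 := congrArg (fun φ : UDual g => φ 1) h1
  have hr : rightMul g z = 0 := by
    ext a
    simp only [rightMul, hz]
    simp
  have h3 : ∀ t : ℂ, velocity t z = 0 := fun t => by
    have hA : A t z = 0 := by
      rw [A, hr, LinearMap.comp_zero, conv, TensorProduct.map_zero_right, LinearMap.zero_comp,
        LinearMap.comp_zero, LinearMap.comp_zero]
    rw [velocity, hr, hA, cvLie, cv, TensorProduct.map_zero_left, LinearMap.zero_comp,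
      LinearMap.comp_zero, LinearMap.comp_zero, add_zero]
  rw [velocityCocycle_apply, velocityCochain_apply, map_one, mul_one] at h2
  simpa [h3] using h2

/-! ### The differential equation and the Maurer-Cartan equation in the Lie algebra -/

theorem inc_comp_injective {F F' : U g →ₗ[ℂ] g}
    (h : (inc g : g →ₗ[ℂ] U g) ∘ₗ F = (inc g : g →ₗ[ℂ] U g) ∘ₗ F') : F = F' :=
  LinearMap.ext fun a => inc_injective (DFunLike.congr_fun h a)

theorem polyDeriv_A (x : g) (a : U g) :
    PolyDeriv (fun t : ℝ => A (t : ℂ) x a) (fun t => velocity (t : ℂ) x a) := by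
  obtain ⟨A', hA, hA'⟩ := exists_polyDeriv_A x
  exact (hA a).congr (fun _ => rfl) fun t =>
    DFunLike.congr_fun (inc_comp_injective (hA' t)).symm a

theorem A_maurerCartan (t : ℝ) (x y : g) :
    A (t : ℂ) y ∘ₗ rightMul g x = A (t : ℂ) x ∘ₗ rightMul g y + A (t : ℂ) ⁅x, y⁆ -
      cvLie (A (t : ℂ) x) (A (t : ℂ) y) := by
  rw [← inc_comp_injective (inc_comp_A_maurerCartan t x y)]
  abel

theorem A_one_eq (x : g) : A 1 x = constFn g x := by
  rw [A_one, inc_injective (inc_toLie g x)]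

/-! ### Trilinear forms on functions with values in the Lie algebra -/

section Trilinear

variable (f : g →ₗ[ℂ] g →ₗ[ℂ] g →ₗ[ℂ] Triv g)

/-- The function `a ↦ ∑ f(F(a⁽¹⁾), G(a⁽²⁾), H(a⁽³⁾))`. -/
def tri (F G H : U g →ₗ[ℂ] g) : U g →ₗ[ℂ] Triv g :=
  cv (TensorProduct.uncurry (RingHom.id ℂ) g g (Triv g) ∘ₗ f) F (cv (TensorProduct.mk ℂ g g) G H)

theorem triLift_comul₃ (F G H : U g →ₗ[ℂ] g) (a : U g) :
    triLift f (TensorProduct.map F (TensorProduct.map G H) (comul₃ g a)) =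
      Triv.val g (tri f F G H a) := by
  simp only [triLift, tri, cv, comul₃, LinearMap.comp_apply, LinearEquiv.coe_coe]
  refine congrArg _ (congrArg _ ?_)
  induction (comul g).toLinearMap a using TensorProduct.induction_on with
  | zero => simp
  | tmul b c => simp [TensorProduct.lift_mk]
  | add b c hb hc => simp only [map_add, hb, hc]

theorem tri_dpow_sum (F G H : U g →ₗ[ℂ] g) (y : g) (m : ℕ) :
    tri f F G H (dpow y m) = ∑ p ∈ antidiagonal m, ∑ q ∈ antidiagonal p.2,
      f (F (dpow y p.1)) (G (dpow y q.1)) (H (dpow y q.2)) := by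
  rw [tri, cv_dpow]
  simp [cv_dpow]

theorem tri_dpow (F G H : U g →ₗ[ℂ] g) (y : g) (m : ℕ) :
    tri f F G H (dpow y m) = ∑ ν ∈ Finset.Nat.antidiagonalTuple 3 m,
      f (F (dpow y (ν 0))) (G (dpow y (ν 1))) (H (dpow y (ν 2))) := by
  rw [tri_dpow_sum]
  exact sum_triple_right m fun i j k => f (F (dpow y i)) (G (dpow y j)) (H (dpow y k))

theorem tri_cvLie_dpow (F G H K : U g →ₗ[ℂ] g) (y : g) (m : ℕ) (σ : Equiv.Perm (Fin 4)) :
    tri f (cvLie F G) H K (dpow y m) = ∑ ν ∈ Finset.Nat.antidiagonalTuple 4 m,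
      f ⁅F (dpow y (ν (σ 0))), G (dpow y (ν (σ 1)))⁆ (H (dpow y (ν (σ 2))))
        (K (dpow y (ν (σ 3)))) := by
  refine Eq.trans ?_ (sum_antidiagonalTuple_perm m σ fun ν =>
    f ⁅F (dpow y (ν 0)), G (dpow y (ν 1))⁆ (H (dpow y (ν 2))) (K (dpow y (ν 3)))).symm
  rw [← sum_quadruple_left m fun i j k l => f ⁅F (dpow y i), G (dpow y j)⁆ (H (dpow y k))
      (K (dpow y l)), tri_dpow_sum]
  simp only [cvLie_dpow, map_sum, LinearMap.sum_apply]

theorem tri_comp_rightMul (F G H : U g →ₗ[ℂ] g) (x : g) :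
    tri f F G H ∘ₗ rightMul g x = tri f (F ∘ₗ rightMul g x) G H +
      tri f F (G ∘ₗ rightMul g x) H + tri f F G (H ∘ₗ rightMul g x) := by
  simp only [tri, cv_comp_rightMul, cv_add_right, add_assoc]

theorem tri_add₁ (F F' G H : U g →ₗ[ℂ] g) : tri f (F + F') G H = tri f F G H + tri f F' G H :=
  cv_add_left _ F F' _

theorem tri_add₂ (F G G' H : U g →ₗ[ℂ] g) : tri f F (G + G') H = tri f F G H + tri f F G' H := by
  simp only [tri, cv_add_left, cv_add_right]

theorem tri_add₃ (F G H H' : U g →ₗ[ℂ] g) : tri f F G (H + H') = tri f F G H + tri f F G H' := by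
  simp only [tri, cv_add_right]

theorem tri_smul₂ (t : ℂ) (F G H : U g →ₗ[ℂ] g) : tri f F (t • G) H = t • tri f F G H := by
  simp only [tri, cv_smul_left, cv_smul_right]

theorem tri_smul₃ (t : ℂ) (F G H : U g →ₗ[ℂ] g) : tri f F G (t • H) = t • tri f F G H := by
  simp only [tri, cv_smul_right]

theorem tri_sub₂ (F G G' H : U g →ₗ[ℂ] g) : tri f F (G - G') H = tri f F G H - tri f F G' H := by
  rw [eq_sub_iff_add_eq, ← tri_add₂, sub_add_cancel]

theorem tri_sub₃ (F G H H' : U g →ₗ[ℂ] g) : tri f F G (H - H') = tri f F G H - tri f F G H' := by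
  rw [eq_sub_iff_add_eq, ← tri_add₃, sub_add_cancel]

theorem tri_zero₁ (G H : U g →ₗ[ℂ] g) : tri f 0 G H = 0 := by
  rw [tri, cv, TensorProduct.map_zero_left, LinearMap.zero_comp, LinearMap.comp_zero]

theorem tri_constFn (x y z : g) :
    tri f (constFn g x) (constFn g y) (constFn g z) = constFn g (f x y z) := by
  rw [tri, cv_constFn, cv_constFn]
  rfl

/-- The Leibniz rule for the derivative with respect to a parameter. -/
theorem polyDeriv_tri {F F' G G' H H' : ℝ → U g →ₗ[ℂ] g}
    (hF : ∀ a, PolyDeriv (fun t => F t a) (fun t => F' t a))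
    (hG : ∀ a, PolyDeriv (fun t => G t a) (fun t => G' t a))
    (hH : ∀ a, PolyDeriv (fun t => H t a) (fun t => H' t a)) (a : U g) :
    PolyDeriv (fun t => tri f (F t) (G t) (H t) a) (fun t =>
      (tri f (F' t) (G t) (H t) + (tri f (F t) (G' t) (H t) + tri f (F t) (G t) (H' t))) a) := by
  refine (polyDeriv_cv _ hF (polyDeriv_cv _ hG hH) a).congr (fun _ => rfl) fun t => ?_
  simp only [tri, cv_add_right]

variable {f}

theorem threeCochain_swap₁₂ (hf : f ∈ threeCochain ℂ g (Triv g)) (x y z : g) :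
    f x y z = -f y x z := by
  have h := hf.1 (x + y) z
  simp only [map_add, LinearMap.add_apply, hf.1, zero_add, add_zero] at h
  rwa [add_comm, ← eq_neg_iff_add_eq_zero] at h

theorem threeCochain_swap₂₃ (hf : f ∈ threeCochain ℂ g (Triv g)) (x y z : g) :
    f x y z = -f x z y := by
  have h := hf.2 x (y + z)
  simp only [map_add, LinearMap.add_apply, hf.2, zero_add, add_zero] at h
  rwa [add_comm, ← eq_neg_iff_add_eq_zero] at h

theorem tri_swap₁₂ (hf : f ∈ threeCochain ℂ g (Triv g)) (F G H : U g →ₗ[ℂ] g) :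
    tri f F G H = -tri f G F H :=
  ext_dpow fun y m => by
    rw [LinearMap.neg_apply, tri_dpow, tri_dpow,
      ← sum_antidiagonalTuple_perm m (Equiv.swap 0 1), ← Finset.sum_neg_distrib]
    exact Finset.sum_congr rfl fun ν _ => threeCochain_swap₁₂ hf _ _ _

theorem tri_swap₂₃ (hf : f ∈ threeCochain ℂ g (Triv g)) (F G H : U g →ₗ[ℂ] g) :
    tri f F G H = -tri f F H G :=
  ext_dpow fun y m => by
    rw [LinearMap.neg_apply, tri_dpow, tri_dpow,
      ← sum_antidiagonalTuple_perm m (Equiv.swap 1 2), ← Finset.sum_neg_distrib]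
    exact Finset.sum_congr rfl fun ν _ => threeCochain_swap₂₃ hf _ _ _

theorem tri_rotate (hf : f ∈ threeCochain ℂ g (Triv g)) (F G H : U g →ₗ[ℂ] g) :
    tri f F G H = tri f G H F := by
  rw [tri_swap₁₂ hf, tri_swap₂₃ hf, neg_neg]

/-- The cocycle identity for `f`, extended to functions with values in `g`. -/
theorem tri_closed (hf : f ∈ threeCocycle ℂ g (Triv g)) (X Y Z Q : U g →ₗ[ℂ] g) :
    tri f (cvLie X Q) Y Z - tri f (cvLie Y Q) X Z + tri f (cvLie Z Q) X Y =
      tri f Q (cvLie X Z) Y - tri f Q (cvLie X Y) Z - tri f Q (cvLie Y Z) X :=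
  ext_dpow fun y m => by
    rw [tri_rotate hf.1 Q, tri_rotate hf.1 Q, tri_rotate hf.1 Q]
    simp only [LinearMap.sub_apply, LinearMap.add_apply]
    rw [tri_cvLie_dpow f X Q Y Z y m (Equiv.swap 1 3 * Equiv.swap 2 3),
      tri_cvLie_dpow f Y Q X Z y m (Equiv.swap 0 1 * Equiv.swap 1 3 * Equiv.swap 2 3),
      tri_cvLie_dpow f Z Q X Y y m (Equiv.swap 0 2 * Equiv.swap 1 3),
      tri_cvLie_dpow f X Z Y Q y m (Equiv.swap 1 2),
      tri_cvLie_dpow f X Y Z Q y m 1,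
      tri_cvLie_dpow f Y Z X Q y m (Equiv.swap 0 1 * Equiv.swap 1 2),
      ← Finset.sum_sub_distrib, ← Finset.sum_sub_distrib, ← Finset.sum_sub_distrib,
      ← Finset.sum_add_distrib]
    refine Finset.sum_congr rfl fun ν _ => ?_
    have h := hf.2 (X (dpow y (ν 0))) (Y (dpow y (ν 1))) (Z (dpow y (ν 2))) (Q (dpow y (ν 3)))
    simp only [dThree, trivial_lie_zero, sub_zero, add_zero, zero_sub] at h
    change f ⁅X (dpow y (ν 0)), Q (dpow y (ν 3))⁆ (Y (dpow y (ν 1))) (Z (dpow y (ν 2))) -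
        f ⁅Y (dpow y (ν 1)), Q (dpow y (ν 3))⁆ (X (dpow y (ν 0))) (Z (dpow y (ν 2))) +
        f ⁅Z (dpow y (ν 2)), Q (dpow y (ν 3))⁆ (X (dpow y (ν 0))) (Y (dpow y (ν 1))) =
      f ⁅X (dpow y (ν 0)), Z (dpow y (ν 2))⁆ (Y (dpow y (ν 1))) (Q (dpow y (ν 3))) -
        f ⁅X (dpow y (ν 0)), Y (dpow y (ν 1))⁆ (Z (dpow y (ν 2))) (Q (dpow y (ν 3))) -
        f ⁅Y (dpow y (ν 1)), Z (dpow y (ν 2))⁆ (X (dpow y (ν 0))) (Q (dpow y (ν 3)))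
    rw [← sub_eq_zero, ← neg_eq_zero, ← h]
    abel

end Trilinear

/-! ### The lift of a three-cocycle -/

section Lift

theorem continuous_tri_A (f : g →ₗ[ℂ] g →ₗ[ℂ] g →ₗ[ℂ] Triv g) (x y : g) (a : U g) :
    Continuous fun t : ℝ => Triv.val g (tri f (prLie g) (A (t : ℂ) x) (A (t : ℂ) y) a) :=
  ((polyDeriv_tri f (F' := 0) (fun a => PolyDeriv.const (prLie g a)) (polyDeriv_A x)
    (polyDeriv_A y) a).map (Triv.val g).toLinearMap).continuous

theorem alphaTilde_eq (f : g →ₗ[ℂ] g →ₗ[ℂ] g →ₗ[ℂ] Triv g) (a : U g) (x y : g) :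
    alphaTilde f a x y =
      ∫ t in (0 : ℝ)..1, Triv.val g (tri f (prLie g) (A (t : ℂ) x) (A (t : ℂ) y) a) :=
  intervalIntegral.integral_congr fun _ _ => triLift_comul₃ f _ _ _ a

/-- For a cocycle `f`, the coboundary of `(x, y) ↦ f(pr, A_t(·, x), A_t(·, y))` is the derivative in
`t` of `f(A_t(·, x), A_t(·, y), A_t(·, z))`. -/
theorem tri_coboundary {f : g →ₗ[ℂ] g →ₗ[ℂ] g →ₗ[ℂ] Triv g} (hf : f ∈ threeCocycle ℂ g (Triv g))
    (t : ℝ) (x y z : g) :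
    tri f (prLie g) (A (t : ℂ) y) (A (t : ℂ) z) ∘ₗ rightMul g x -
      tri f (prLie g) (A (t : ℂ) x) (A (t : ℂ) z) ∘ₗ rightMul g y +
      tri f (prLie g) (A (t : ℂ) x) (A (t : ℂ) y) ∘ₗ rightMul g z -
      tri f (prLie g) (A (t : ℂ) ⁅x, y⁆) (A (t : ℂ) z) +
      tri f (prLie g) (A (t : ℂ) ⁅x, z⁆) (A (t : ℂ) y) -
      tri f (prLie g) (A (t : ℂ) ⁅y, z⁆) (A (t : ℂ) x) =
    tri f (velocity (t : ℂ) x) (A (t : ℂ) y) (A (t : ℂ) z) +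
      (tri f (A (t : ℂ) x) (velocity (t : ℂ) y) (A (t : ℂ) z) +
        tri f (A (t : ℂ) x) (A (t : ℂ) y) (velocity (t : ℂ) z)) := by
  have h := tri_closed hf (A (t : ℂ) x) (A (t : ℂ) y) (A (t : ℂ) z) (prLie g)
  rw [tri_swap₁₂ hf.1 (A (t : ℂ) x) (velocity (t : ℂ) y), ← tri_rotate hf.1 (velocity (t : ℂ) z)]
  simp only [velocity, tri_comp_rightMul, tri_add₁]
  -- the Maurer-Cartan equation eliminates the terms in which `A_y` is translated by `x`, and those
  -- in which `A_z` is translated by `x` or `y`; their other right translates then cancel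
  rw [A_maurerCartan t x y, A_maurerCartan t x z, A_maurerCartan t y z,
    tri_swap₂₃ hf.1 _ (A (t : ℂ) x ∘ₗ rightMul g z) (A (t : ℂ) y),
    tri_swap₂₃ hf.1 _ (A (t : ℂ) ⁅x, z⁆) (A (t : ℂ) y),
    tri_swap₂₃ hf.1 _ (A (t : ℂ) ⁅y, z⁆) (A (t : ℂ) x)]
  rw [tri_swap₂₃ hf.1 _ (cvLie (A (t : ℂ) x) (A (t : ℂ) z)) (A (t : ℂ) y),
    tri_swap₂₃ hf.1 _ (cvLie (A (t : ℂ) y) (A (t : ℂ) z)) (A (t : ℂ) x), ← sub_eq_zero,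
    ← neg_eq_zero] at h
  simp only [tri_add₂, tri_add₃, tri_sub₂, tri_sub₃]
  rw [← sub_eq_zero, ← h]
  abel

/-- The cochain `∫₀¹ f(pr, A_t(·, x), A_t(·, y)) dt` with values in the dual of `Ug`. -/
def lift {f : g →ₗ[ℂ] g →ₗ[ℂ] g →ₗ[ℂ] Triv g} (hf : f ∈ threeCochain ℂ g (Triv g)) :
    twoCochain ℂ g (UDual g) :=
  ⟨LinearMap.mk₂ ℂ
    (fun x y => (integralDual g
      (fun t : ℝ => (Triv.val g).toLinearMap ∘ₗ tri f (prLie g) (A (t : ℂ) x) (A (t : ℂ) y))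
      (continuous_tri_A f x y) : UDual g))
    (fun x x' y => by
      ext a
      refine Eq.trans ?_ (intervalIntegral.integral_add
        ((continuous_tri_A f x y a).intervalIntegrable _ _)
        ((continuous_tri_A f x' y a).intervalIntegrable _ _))
      refine intervalIntegral.integral_congr fun t _ => ?_
      simp [A_add, tri_add₂])
    (fun s x y => by
      ext a
      refine Eq.trans ?_ (intervalIntegral.integral_const_mul s _)
      refine intervalIntegral.integral_congr fun t _ => ?_
      simp [A_smul, tri_smul₂])
    (fun x y y' => by
      ext a
      refine Eq.trans ?_ (intervalIntegral.integral_add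
        ((continuous_tri_A f x y a).intervalIntegrable _ _)
        ((continuous_tri_A f x y' a).intervalIntegrable _ _))
      refine intervalIntegral.integral_congr fun t _ => ?_
      simp [A_add, tri_add₃])
    (fun s x y => by
      ext a
      refine Eq.trans ?_ (intervalIntegral.integral_const_mul s _)
      refine intervalIntegral.integral_congr fun t _ => ?_
      simp [A_smul, tri_smul₃]), fun x => by
    ext a
    refine Eq.trans (intervalIntegral.integral_congr (g := fun _ => (0 : ℂ)) fun t _ => ?_)
      intervalIntegral.integral_zero
    exact self_eq_neg.mp ((congrArg (fun F => Triv.val g (F a)) (tri_swap₂₃ hf (prLie g)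
      (A (t : ℂ) x) (A (t : ℂ) x))).trans (map_neg (Triv.val g) _))⟩

theorem lift_apply {f : g →ₗ[ℂ] g →ₗ[ℂ] g →ₗ[ℂ] Triv g} (hf : f ∈ threeCochain ℂ g (Triv g))
    (x y : g) (a : U g) : lift hf x y a =
      ∫ t in (0 : ℝ)..1, Triv.val g (tri f (prLie g) (A (t : ℂ) x) (A (t : ℂ) y) a) := rfl

theorem augIncl_apply (z : Triv g) (a : U g) : augIncl g z a = Triv.val g z * counit g a := rfl

/-- The coboundary of `lift` is `ε f`: the right-hand side of `tri_coboundary` integrates to the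
difference of the values of `f(A_t(·, x), A_t(·, y), A_t(·, z))` at `t = 1` and `t = 0`. -/
theorem d₂₃_lift {f : g →ₗ[ℂ] g →ₗ[ℂ] g →ₗ[ℂ] Triv g} (hf : f ∈ threeCocycle ℂ g (Triv g))
    (x y z : g) : augIncl g (f x y z) = d₂₃ ℂ g (UDual g) (lift hf.1) x y z := by
  ext a
  have h1 := ((polyDeriv_tri f (polyDeriv_A x) (polyDeriv_A y) (polyDeriv_A z) a).map
    (Triv.val g).toLinearMap).integral_eq_sub
  simp only [← tri_coboundary hf] at h1
  have hi : ∀ (x y : g) (a : U g), IntervalIntegrable (fun t : ℝ => Triv.val g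
      (tri f (prLie g) (A (t : ℂ) x) (A (t : ℂ) y) a)) MeasureTheory.volume 0 1 :=
    fun x y a => (continuous_tri_A f x y a).intervalIntegrable _ _
  have h2 : ∀ φ ψ : UDual g, (φ - ψ) a = φ a - ψ a := fun _ _ => rfl
  rw [d₂₃_apply]
  simp only [h2, UDual.add_apply, UDual.lie_apply, lift_apply]
  rw [← intervalIntegral.integral_sub (hi _ _ _) (hi _ _ _),
    ← intervalIntegral.integral_add ((hi _ _ _).sub (hi _ _ _)) (hi _ _ _),
    ← intervalIntegral.integral_sub (((hi _ _ _).sub (hi _ _ _)).add (hi _ _ _)) (hi _ _ _),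
    ← intervalIntegral.integral_add
      ((((hi _ _ _).sub (hi _ _ _)).add (hi _ _ _)).sub (hi _ _ _)) (hi _ _ _),
    ← intervalIntegral.integral_sub
      (((((hi _ _ _).sub (hi _ _ _)).add (hi _ _ _)).sub (hi _ _ _)).add (hi _ _ _)) (hi _ _ _)]
  refine Eq.trans ?_ (h1.symm.trans (intervalIntegral.integral_congr fun t _ => ?_))
  · simp only [Complex.ofReal_one, Complex.ofReal_zero, A_one_eq, tri_constFn, A_zero, tri_zero₁,
      LinearMap.zero_apply, map_zero, sub_zero, constFn_apply, augIncl_apply]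
    simp [mul_comm]
  · simp [rightMul]

/-- The restriction of `lift` to the augmentation ideal. -/
def augLift (f : threeCocycle ℂ g (Triv g)) : twoCocycle ℂ g (AugDual g) :=
  ⟨⟨(lift f.2.1).1.compr₂ (augRestrict g : UDual g →ₗ[ℂ] AugDual g), fun x => by simp⟩, by
    rw [mem_twoCocycle_iff]
    ext x y z : 3
    have h := congrArg (augRestrict g) (d₂₃_lift f.2 x y z)
    rw [(aug_exact g _).mpr ⟨_, rfl⟩, d₂₃_apply] at h
    simp only [map_add, map_sub, LieModuleHom.map_lie] at h
    exact h.symm⟩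

theorem isLiftOf_augLift (f : threeCocycle ℂ g (Triv g)) : IsLiftOf (augLift f) f :=
  fun x y a => (alphaTilde_eq f.1 a x y).symm

theorem augYoneda_represents (f : threeCocycle ℂ g (Triv g)) :
    (augYoneda g (augLift f)).Represents (LieH3.mk ℂ g (Triv g) f) :=
  yonedaProduct_represents _ _ _ _ _ _ (lift f.2.1) (fun _ _ => rfl) f (d₂₃_lift f.2)

end Lift

end Env

end

theorem mainTheorem3 (g : Type u) [LieRing g] [LieAlgebra ℂ g] :
    -- the Yoneda product is a crossed module, and its equivalence class corresponds to `[f]`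
    (∀ f : threeCocycle ℂ g (Env.Triv g), ∃ α : twoCocycle ℂ g (Env.AugDual g),
      Env.IsLiftOf α f ∧
      IsLieCrossedModule (Env.augYoneda g α).μ (Env.augYoneda g α).act ∧
      (Env.augYoneda g α).Represents (LieH3.mk ℂ g (Env.Triv g) f) ∧
      ∀ (X : CrossedExtension ℂ g (Env.Triv g)) (c : LieH3 ℂ g (Env.Triv g)), X.Represents c →
        (X.Equivalent (Env.augYoneda g α) ↔ c = LieH3.mk ℂ g (Env.Triv g) f)) ∧
    -- every class in `H³(g, ℂ)` has such an abelian representative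
    (∀ c : LieH3 ℂ g (Env.Triv g), ∃ (f : threeCocycle ℂ g (Env.Triv g))
      (α : twoCocycle ℂ g (Env.AugDual g)),
      LieH3.mk ℂ g (Env.Triv g) f = c ∧ Env.IsLiftOf α f ∧
      (Env.augYoneda g α).Represents c ∧
      ∀ X : CrossedExtension ℂ g (Env.Triv g), X.Represents c →
        X.Equivalent (Env.augYoneda g α)) ∧
    -- the (arbitrarily normalized) Cartan cocycle of a simple Lie algebra
    (Module.Finite ℂ g → LieAlgebra.IsSimple ℂ g → ∀ s : ℂ,
      ∃ α : twoCocycle ℂ g (Env.AugDual g),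
        Env.IsLiftOf α (s • Env.cartanCocycle g) ∧
        (Env.augYoneda g α).Represents (LieH3.mk ℂ g (Env.Triv g) (s • Env.cartanCocycle g)) ∧
        ∀ X : CrossedExtension ℂ g (Env.Triv g),
          X.Represents (LieH3.mk ℂ g (Env.Triv g) (s • Env.cartanCocycle g)) →
          X.Equivalent (Env.augYoneda g α)) := by
  have key : ∀ f : threeCocycle ℂ g (Env.Triv g),
      ∀ (X : CrossedExtension ℂ g (Env.Triv g)) (c : LieH3 ℂ g (Env.Triv g)), X.Represents c →
        (X.Equivalent (Env.augYoneda g (Env.augLift f)) ↔ c = LieH3.mk ℂ g (Env.Triv g) f) :=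
    fun f _ _ hX => CrossedExtension.equivalent_iff hX (Env.augYoneda_represents f)
  refine ⟨fun f => ⟨Env.augLift f, Env.isLiftOf_augLift f,
      (Env.augYoneda g (Env.augLift f)).isCrossed, Env.augYoneda_represents f, key f⟩,
    fun c => ?_, fun _ _ s => ⟨Env.augLift _, Env.isLiftOf_augLift _, Env.augYoneda_represents _,
      fun X hX => (key _ X _ hX).mpr rfl⟩⟩
  obtain ⟨f, rfl⟩ : ∃ f, LieH3.mk ℂ g (Env.Triv g) f = c := Submodule.mkQ_surjective _ c
  exact ⟨f, Env.augLift f, rfl, Env.isLiftOf_augLift f, Env.augYoneda_represents f,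
    fun X hX => (key f X _ hX).mpr rfl⟩
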